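/- All graphs are finite and simple. A class of graphs is hereditary if it is closed under isomorphism and induced subgraphs. The graph-intersection of two classes $\mathcal G_1,\mathcal G_2$ is the class of all graphs $(V(G_1)\cap V(G_2),E(G_1)\cap E(G_2))$ with $G_1\in\mathcal G_1$, $G_2\in\mathcal G_2$. A graph is trivially perfect if in each of its non-null induced subgraphs the independence number equals the number of maximal cliques. A graph is strongly chordal if it has no induced cycle of length at least $4$ and every (not necessarily induced) cycle $v_1\cdots v_{2l}$ with $l\ge 3$ has an odd chord, i.e. a chord $v_iv_j$ with $i\not\equiv j \pmod 2$. Burling graphs. Families $\mathcal B_k$ of axis-parallel boxes in $\mathbb R^3$ and families $\mathcal P_k$ of rectangles in the $yz$-plane ("probes") are defined recursively. $\mathcal B_1=\{[0,1]^3\}$, $\mathcal P_1=\{[0,1]^2\}$, $w_1=1$. Given $\mathcal B_k$, $\mathcal P_k$, $w_k$, for $P=[y_0,y_1]\times[z_0,z_1]\in\mathcal P_k$ let $\phi_P$ be the increasing coordinatewise affine map of $[0,1]^2$ onto $[y_0,y_1]\times[z_0,\tfrac{z_0+z_1}{2}]$, and for $Q\in\mathcal P_k$ write $\phi_P(Q)=[a,b]\times[c,d]$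 and $\delta=\tfrac{b-a}{3}$. Then $\mathcal B_{k+1}$ consists of the boxes of $\mathcal B_k$ translated by $w_k+1$ in direction $x$, of the boxes $I\times\phi_P(R)$ for $P\in\mathcal P_k$, $I\times R\in\mathcal B_k$, and of the boxes $[0,w_k]\times[a,a+\delta]\times[d,z_1]$ for $P,Q\in\mathcal P_k$; $\mathcal P_{k+1}$ consists of the rectangles $[b-\delta,b]\times[c,d]$ and $[a,a+\delta]\times[z_1-\tfrac{z_1-z_0}{4},z_1]$ for $P,Q\in\mathcal P_k$; and $w_{k+1}=2w_k+1$. Let $G_k$ be the intersection graph of $\mathcal B_k$ (two distinct boxes are adjacent if they intersect). A Burling graph is a graph isomorphic to an induced subgraph of some $G_k$, $k\ge1$. Burling strongly chordal graphs. A Burling tree $(T,r,l,c)$ consists of a finite tree $T$ with root $r$, a function $l$ that assigns to each non-leaf vertex $v$ one child of $v$, called the last-born of $v$ (a leaf is a vertex without children), and a function $c$ from $V(T)$ to subsets of $V(T)$ such that $c(v)=\emptyset$ if $v$ is the root or a last-born, and otherwise $c(v)$ is empty or the vertex set of a branch starting at the last-born of the parent of $v$. Here a branch is a path each of whose vertices,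 except the first, is a child of the previous one; it is principal if it starts at $r$ and ends at a leaf. Let $C(T)$ be the graph on $V(T)$ in which two distinct vertices $u,v$ are adjacent if and only if $v\in c(u)$, or $u\in c(v)$, or some principal branch contains both. A graph is Burling strongly chordal if it is isomorphic to an induced subgraph of $C(T)$ for some Burling tree $(T,r,l,c)$. **Theorem.** The class of Burling strongly chordal graphs is a hereditary, proper subclass of the class of strongly chordal graphs, and every Burling graph belongs to the graph-intersection of the class of trivially perfect graphs with the class of Burling strongly chordal graphs. -/

import Mathlib

/-! ### Finite graphs and graph classes -/

/-- A finite simple graph. Finite graphs up to isomorphism all live in `Type`. -/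
structure FinGraph where
  V : Type
  [finite : Finite V]
  graph : SimpleGraph V

attribute [instance] FinGraph.finite

/-- A class of graphs is hereditary if it is closed under isomorphism and induced subgraphs:
`H.graph ↪g G.graph` is an isomorphism of `H` onto an induced subgraph of `G`. -/
def IsHereditary (𝒢 : Set FinGraph) : Prop :=
  ∀ G ∈ 𝒢, ∀ H : FinGraph, Nonempty (H.graph ↪g G.graph) → H ∈ 𝒢

/-- The graph-intersection of two classes: all graphs `G₁ ∩ G₂` with `Gᵢ` in the `i`-th class.
Both graphs are taken on the vertex set of the intersection, which for hereditary classes is no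
restriction. -/
def graphIntersection (𝒢₁ 𝒢₂ : Set FinGraph) : Set FinGraph :=
  {G | ∃ G₁ G₂ : SimpleGraph G.V,
    FinGraph.mk G.V G₁ ∈ 𝒢₁ ∧ FinGraph.mk G.V G₂ ∈ 𝒢₂ ∧ G.graph = G₁ ⊓ G₂}

/-- Trivially perfect graphs: in every (non-null) induced subgraph, the independence number equals
the number of maximal cliques. -/
def triviallyPerfectGraphs : Set FinGraph :=
  {G | ∀ s : Set G.V, s.Nonempty →
    (G.graph.induce s).indepNum = {c : Set s | Maximal (G.graph.induce s).IsClique c}.ncard}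

/-- No induced cycle of length at least four. -/
def IsChordal {V : Type} (G : SimpleGraph V) : Prop :=
  ∀ n : ℕ, 4 ≤ n → IsEmpty (SimpleGraph.cycleGraph n ↪g G)

/-- Strongly chordal graphs: chordal graphs in which every cycle `v₀, …, v₂ₗ₋₁` with `l ≥ 3` has an
odd chord, i.e. an edge `vᵢvⱼ` of the graph that is not an edge of the cycle and whose indices
have different parity. -/
def stronglyChordalGraphs : Set FinGraph :=
  {G | IsChordal G.graph ∧
    ∀ l : ℕ, 3 ≤ l → ∀ v : SimpleGraph.Copy (SimpleGraph.cycleGraph (2 * l)) G.graph,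
      ∃ i j : Fin (2 * l), G.graph.Adj (v i) (v j) ∧
        ¬ (SimpleGraph.cycleGraph (2 * l)).Adj i j ∧ i.val % 2 ≠ j.val % 2}

/-! ### The Burling sequence

The families of boxes `𝓑 k` in `ℝ³` are built together with families of probes. A probe is a
rectangle `R` in the `yz`-plane; the boxes that the column `ℝ × R` meets are pairwise disjoint.
The next family consists of

* one translated copy of the current family;
* for each probe `P`, a small copy of the current family, inside the column of `P` and next to
  the translated copy;
* for each pair of probes `P, Q`, one box that meets exactly those boxes of the small copy in `P`
  which the copy of `Q` inside `P` meets.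

Each pair `P, Q` gives rise to two new probes: one meets the boxes of the translated copy that `P`
meets and the boxes of the small copy in `P` that `Q` meets, the other one meets the boxes of the
translated copy that `P` meets and the new box of the pair. -/

namespace Burling

/-- Index set of the probes; the family numbered `k` here is the `(k+1)`-st of the sequence. -/
def ProbeIdx : ℕ → Type
  | 0 => Unit
  | k + 1 => ProbeIdx k × ProbeIdx k × Bool

/-- Index set of the boxes. -/
def BoxIdx : ℕ → Type
  | 0 => Unit
  | k + 1 => BoxIdx k ⊕ (ProbeIdx k × BoxIdx k) ⊕ (ProbeIdx k × ProbeIdx k)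

/-- The rectangle `[y₀, y₁] × [z₀, z₁]`. -/
@[ext] structure Rect where
  (y₀ y₁ z₀ z₁ : ℝ)

/-- The box `[x₀, x₁] × [y₀, y₁] × [z₀, z₁]`. -/
@[ext] structure Box extends Rect where
  (x₀ x₁ : ℝ)

/-- The axis-parallel box as a subset of `ℝ³`. -/
def Box.toSet (b : Box) : Set (ℝ × ℝ × ℝ) :=
  Set.Icc b.x₀ b.x₁ ×ˢ Set.Icc b.y₀ b.y₁ ×ˢ Set.Icc b.z₀ b.z₁

/-- The image of `R` under the affine map that sends the unit square onto the lower half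
`[P.y₀, P.y₁] × [P.z₀, (P.z₀ + P.z₁) / 2]` of `P`. -/
noncomputable def Rect.placeIn (P R : Rect) : Rect where
  y₀ := P.y₀ + (P.y₁ - P.y₀) * R.y₀
  y₁ := P.y₀ + (P.y₁ - P.y₀) * R.y₁
  z₀ := P.z₀ + (P.z₁ - P.z₀) / 2 * R.z₀
  z₁ := P.z₀ + (P.z₁ - P.z₀) / 2 * R.z₁

/-- All boxes of the family `k` lie in `[0, width k] × [0, 1] × [0, 1]`. -/
def width : ℕ → ℝ
  | 0 => 1
  | k + 1 => 2 * width k + 1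

/-- The probes. -/
noncomputable def probe : (k : ℕ) → ProbeIdx k → Rect
  | 0, _ => ⟨0, 1, 0, 1⟩
  | k + 1, (P, Q, false) =>
      let p := probe k P
      let q := p.placeIn (probe k Q)
      ⟨q.y₁ - (q.y₁ - q.y₀) / 3, q.y₁, q.z₀, q.z₁⟩
  | k + 1, (P, Q, true) =>
      let p := probe k P
      let q := p.placeIn (probe k Q)
      ⟨q.y₀, q.y₀ + (q.y₁ - q.y₀) / 3, p.z₁ - (p.z₁ - p.z₀) / 4, p.z₁⟩

/-- The boxes. -/
noncomputable def box : (k : ℕ) → BoxIdx k → Box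
  | 0, _ => ⟨⟨0, 1, 0, 1⟩, 0, 1⟩
  | k + 1, .inl v =>
      ⟨(box k v).toRect, (box k v).x₀ + (width k + 1), (box k v).x₁ + (width k + 1)⟩
  | k + 1, .inr (.inl (P, v)) =>
      ⟨(probe k P).placeIn (box k v).toRect, (box k v).x₀, (box k v).x₁⟩
  | k + 1, .inr (.inr (P, Q)) =>
      let p := probe k P
      let q := p.placeIn (probe k Q)
      ⟨⟨q.y₀, q.y₀ + (q.y₁ - q.y₀) / 3, q.z₁, p.z₁⟩, 0, width k⟩

end Burling

/-- The intersection graph of an indexed family of sets. -/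
def intersectionGraph {ι α : Type*} (A : ι → Set α) : SimpleGraph ι where
  Adj i j := i ≠ j ∧ (A i ∩ A j).Nonempty
  symm := ⟨fun _ _ h => ⟨h.1.symm, Set.inter_comm _ _ ▸ h.2⟩⟩
  loopless := ⟨fun _ h => h.1 rfl⟩

/-- The Burling sequence, starting with `burlingSequence 0`, the one-vertex graph. -/
def burlingSequence (k : ℕ) : SimpleGraph (Burling.BoxIdx k) :=
  intersectionGraph fun v => (Burling.box k v).toSet

/-- Burling graphs: the graphs isomorphic to an induced subgraph of a graph of the Burling
sequence. -/
def burlingGraphs : Set FinGraph :=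
  {G | ∃ k : ℕ, Nonempty (G.graph ↪g burlingSequence k)}

/-! ### The combinatorial description of the Burling sequence

The definition of the boxes is checked here against the usual abstract construction: from a graph
with a family of stable sets, take a copy `G` of it; for each stable set `P`, take a further copy
`G_P`; for each stable set `Q` of `G_P`, add a vertex adjacent to exactly the vertices of `Q`; the
new stable sets are `P ∪ Q` and `P` with the added vertex. -/

namespace Burling

/-- Abstract description of the stable sets of the Burling sequence: `Stabs k P v` says that the
vertex `v` belongs to the stable set `P`. -/
def Stabs : (k : ℕ) → ProbeIdx k → BoxIdx k → Prop
  | 0, _, _ => True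
  | k + 1, (P, _, _), .inl v => Stabs k P v
  | k + 1, (P, Q, b), .inr (.inl (P', v)) => b = false ∧ P' = P ∧ Stabs k Q v
  | _ + 1, (P, Q, b), .inr (.inr (P', Q')) => b = true ∧ P' = P ∧ Q' = Q

/-- Abstract description of the edges of the Burling sequence. -/
def AbstractAdj : (k : ℕ) → BoxIdx k → BoxIdx k → Prop
  | 0, _, _ => False
  | k + 1, .inl u, .inl v => AbstractAdj k u v
  | k + 1, .inr (.inl (P, u)), .inr (.inl (P', v)) => P = P' ∧ AbstractAdj k u v
  | k + 1, .inr (.inl (P, u)), .inr (.inr (P', Q)) => P = P' ∧ Stabs k Q u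
  | k + 1, .inr (.inr (P', Q)), .inr (.inl (P, u)) => P = P' ∧ Stabs k Q u
  | _ + 1, _, _ => False

theorem toSet_inter_nonempty {a b : Box} (ha : a.x₀ ≤ a.x₁ ∧ a.y₀ ≤ a.y₁ ∧ a.z₀ ≤ a.z₁)
    (hb : b.x₀ ≤ b.x₁ ∧ b.y₀ ≤ b.y₁ ∧ b.z₀ ≤ b.z₁) :
    (a.toSet ∩ b.toSet).Nonempty ↔ (a.x₀ ≤ b.x₁ ∧ b.x₀ ≤ a.x₁) ∧
      (a.y₀ ≤ b.y₁ ∧ b.y₀ ≤ a.y₁) ∧ (a.z₀ ≤ b.z₁ ∧ b.z₀ ≤ a.z₁) := by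
  simp only [Box.toSet, Set.prod_inter_prod, Set.prod_nonempty_iff, Set.Icc_inter_Icc,
    Set.nonempty_Icc, sup_le_iff, le_inf_iff]
  tauto

theorem width_pos (k : ℕ) : 0 < width k := by
  induction k with
  | zero => simp [width]
  | succ k ih => simp only [width]; linarith

theorem probe_bounds (k : ℕ) (P : ProbeIdx k) :
    0 ≤ (probe k P).y₀ ∧ (probe k P).y₀ < (probe k P).y₁ ∧ (probe k P).y₁ ≤ 1 ∧
    0 ≤ (probe k P).z₀ ∧ (probe k P).z₀ < (probe k P).z₁ ∧ (probe k P).z₁ ≤ 1 := by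
  induction k with
  | zero => simp [probe]
  | succ k ih =>
    obtain ⟨P, Q, b⟩ := P
    obtain ⟨p1, p2, p3, p4, p5, p6⟩ := ih P
    obtain ⟨q1, q2, q3, q4, q5, q6⟩ := ih Q
    cases b <;> simp only [probe, Rect.placeIn] <;>
    generalize probe k P = p at * <;> generalize probe k Q = q at * <;>
    refine ⟨?_, ?_, ?_, ?_, ?_, ?_⟩ <;> nlinarith [mul_nonneg (sub_pos.2 p2).le q1,
      mul_nonneg (sub_pos.2 p5).le q4, mul_pos (sub_pos.2 p2) (sub_pos.2 q2),
      mul_pos (sub_pos.2 p5) (sub_pos.2 q5), mul_nonneg (sub_pos.2 p2).le (sub_nonneg.2 q3),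
      mul_nonneg (sub_pos.2 p5).le (sub_nonneg.2 q6)]

theorem placeIn_le {p : Rect} (hy : p.y₀ < p.y₁) (hz : p.z₀ < p.z₁) (a b : ℝ) :
    (p.y₀ + (p.y₁ - p.y₀) * a ≤ p.y₀ + (p.y₁ - p.y₀) * b ↔ a ≤ b) ∧
    (p.z₀ + (p.z₁ - p.z₀) / 2 * a ≤ p.z₀ + (p.z₁ - p.z₀) / 2 * b ↔ a ≤ b) :=
  ⟨by rw [add_le_add_iff_left, mul_le_mul_iff_right₀ (by linarith)],
    by rw [add_le_add_iff_left, mul_le_mul_iff_right₀ (by linarith)]⟩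

/-- A rectangle in the unit square is placed into the lower half of `p`. -/
theorem placeIn_bounds {p : Rect} (hy : p.y₀ < p.y₁) (hz : p.z₀ < p.z₁) (a : ℝ) (h0 : 0 ≤ a)
    (h1 : a ≤ 1) : p.y₀ ≤ p.y₀ + (p.y₁ - p.y₀) * a ∧ p.y₀ + (p.y₁ - p.y₀) * a ≤ p.y₁ ∧
    p.z₀ ≤ p.z₀ + (p.z₁ - p.z₀) / 2 * a ∧
    p.z₀ + (p.z₁ - p.z₀) / 2 * a ≤ p.z₁ - (p.z₁ - p.z₀) / 2 := by
  refine ⟨?_, ?_, ?_, ?_⟩ <;> nlinarith [mul_nonneg (sub_pos.2 hy).le h0,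
    mul_nonneg (sub_pos.2 hz).le h0, mul_nonneg (sub_pos.2 hy).le (sub_nonneg.2 h1),
    mul_nonneg (sub_pos.2 hz).le (sub_nonneg.2 h1)]

theorem box_bounds (k : ℕ) (v : BoxIdx k) :
    (0 ≤ (box k v).x₀ ∧ (box k v).x₀ ≤ (box k v).x₁ ∧ (box k v).x₁ ≤ width k) ∧
    (0 ≤ (box k v).y₀ ∧ (box k v).y₀ ≤ (box k v).y₁ ∧ (box k v).y₁ ≤ 1) ∧
    (0 ≤ (box k v).z₀ ∧ (box k v).z₀ ≤ (box k v).z₁ ∧ (box k v).z₁ ≤ 1) := by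
  induction k with
  | zero => simp [box, width]
  | succ k ih =>
    have hw := width_pos k
    rcases v with v | ⟨P, v⟩ | ⟨P, Q⟩
    · have := ih v
      simp only [box, width]
      refine ⟨⟨?_, ?_, ?_⟩, this.2⟩ <;> linarith [this.1.1, this.1.2.1, this.1.2.2]
    · obtain ⟨⟨a1, a2, a3⟩, ⟨a4, a5, a6⟩, a7, a8, a9⟩ := ih v
      obtain ⟨p1, p2, p3, p4, p5, p6⟩ := probe_bounds k P
      have h0 := placeIn_bounds p2 p5 _ a4 (a5.trans a6)
      have h1 := placeIn_bounds p2 p5 _ (a4.trans a5) a6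
      have h2 := placeIn_bounds p2 p5 _ a7 (a8.trans a9)
      have h3 := placeIn_bounds p2 p5 _ (a7.trans a8) a9
      simp only [box, width, Rect.placeIn, (placeIn_le p2 p5 _ _).1, (placeIn_le p2 p5 _ _).2]
      refine ⟨⟨a1, a2, ?_⟩, ⟨?_, a5, ?_⟩, ?_, a8, ?_⟩ <;> linarith
    · obtain ⟨p1, p2, p3, p4, p5, p6⟩ := probe_bounds k P
      obtain ⟨q1, q2, q3, q4, q5, q6⟩ := probe_bounds k Q
      have h0 := placeIn_bounds p2 p5 _ q1 (q2.le.trans q3)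
      have h1 := placeIn_bounds p2 p5 _ (q1.trans q2.le) q3
      have h3 := placeIn_bounds p2 p5 _ (q4.trans q5.le) q6
      have h4 := (placeIn_le p2 p5 _ _).1.2 q2.le
      simp only [box, width, Rect.placeIn]
      refine ⟨⟨le_rfl, ?_, ?_⟩, ⟨?_, ?_, ?_⟩, ?_, ?_, ?_⟩ <;> linarith

/-- The `y`-projections of two distinct probes are disjoint. -/
theorem probe_disjoint (k : ℕ) (R R' : ProbeIdx k) (h : R ≠ R') :
    (probe k R).y₁ < (probe k R').y₀ ∨ (probe k R').y₁ < (probe k R).y₀ := by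
  induction k with
  | zero => exact absurd (Subsingleton.elim (α := Unit) R R') h
  | succ k ih =>
    obtain ⟨P, Q, b⟩ := R
    obtain ⟨P', Q', b'⟩ := R'
    obtain ⟨p1, p2, p3, p4, p5, p6⟩ := probe_bounds k P
    obtain ⟨q1, q2, q3, q4, q5, q6⟩ := probe_bounds k Q
    obtain ⟨p1', p2', p3', p4', p5', p6'⟩ := probe_bounds k P'
    obtain ⟨q1', q2', q3', q4', q5', q6'⟩ := probe_bounds k Q'
    have h0 := placeIn_bounds p2 p5 _ q1 (q2.le.trans q3)
    have h1 := placeIn_bounds p2 p5 _ (q1.trans q2.le) q3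
    have h0' := placeIn_bounds p2' p5' _ q1' (q2'.le.trans q3')
    have h1' := placeIn_bounds p2' p5' _ (q1'.trans q2'.le) q3'
    have h4 := lt_of_not_ge (mt (placeIn_le p2 p5 _ _).1.1 q2.not_ge)
    have h4' := lt_of_not_ge (mt (placeIn_le p2' p5' _ _).1.1 q2'.not_ge)
    by_cases hP : P = P'
    · subst hP
      by_cases hQ : Q = Q'
      · subst hQ
        cases b <;> cases b' <;> simp only [probe, Rect.placeIn] <;>
          first | exact absurd rfl h | (left; linarith) | (right; linarith)
      · rcases ih Q Q' hQ with h5 | h5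
        · have h6 := lt_of_not_ge (mt (placeIn_le p2 p5 _ _).1.1 h5.not_ge)
          left; cases b <;> cases b' <;> simp only [probe, Rect.placeIn] <;> linarith
        · have h6 := lt_of_not_ge (mt (placeIn_le p2 p5 _ _).1.1 h5.not_ge)
          right; cases b <;> cases b' <;> simp only [probe, Rect.placeIn] <;> linarith
    · rcases ih P P' hP with h5 | h5
      · left; cases b <;> cases b' <;> simp only [probe, Rect.placeIn] <;> linarith
      · right; cases b <;> cases b' <;> simp only [probe, Rect.placeIn] <;> linarith

/-- A box in the stable set of a probe covers the probe, every other box misses the region of the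
column above the bottom of the probe. -/
theorem stabs_iff (k : ℕ) (P : ProbeIdx k) (v : BoxIdx k) :
    (Stabs k P v ∧ ((box k v).y₀ ≤ (probe k P).y₀ ∧ (probe k P).y₁ ≤ (box k v).y₁ ∧
      (box k v).z₀ ≤ (probe k P).z₀ ∧ (probe k P).z₁ ≤ (box k v).z₁)) ∨
    (¬ Stabs k P v ∧ ((box k v).y₁ < (probe k P).y₀ ∨ (probe k P).y₁ < (box k v).y₀ ∨
      (box k v).z₁ < (probe k P).z₀)) := by
  induction k with
  | zero => left; simp [Stabs, box, probe]
  | succ k ih =>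
    obtain ⟨P, Q, b⟩ := P
    obtain ⟨p1, p2, p3, p4, p5, p6⟩ := probe_bounds k P
    obtain ⟨q1, q2, q3, q4, q5, q6⟩ := probe_bounds k Q
    have h0 := placeIn_bounds p2 p5 _ q1 (q2.le.trans q3)
    have h1 := placeIn_bounds p2 p5 _ (q1.trans q2.le) q3
    have h2 := placeIn_bounds p2 p5 _ q4 (q5.le.trans q6)
    have h3 := placeIn_bounds p2 p5 _ (q4.trans q5.le) q6
    have h4 := lt_of_not_ge (mt (placeIn_le p2 p5 _ _).1.1 q2.not_ge)
    have h5 := lt_of_not_ge (mt (placeIn_le p2 p5 _ _).2.1 q5.not_ge)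
    rcases v with v | ⟨P', v⟩ | ⟨P', Q'⟩
    · rcases ih P v with ⟨h, e1, e2, e3, e4⟩ | ⟨h, e⟩
      · left
        refine ⟨h, ?_⟩
        cases b <;> simp only [probe, box, Rect.placeIn] <;>
          refine ⟨?_, ?_, ?_, ?_⟩ <;> linarith
      · right
        refine ⟨h, ?_⟩
        cases b <;> simp only [probe, box, Rect.placeIn] <;>
          exact e.imp (fun e => by linarith) (Or.imp (fun e => by linarith) (fun e => by linarith))
    · obtain ⟨p1', p2', p3', p4', p5', p6'⟩ := probe_bounds k P'
      obtain ⟨-, ⟨a4, a5, a6⟩, a7, a8, a9⟩ := box_bounds k v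
      have g0 := placeIn_bounds p2' p5' _ a4 (a5.trans a6)
      have g1 := placeIn_bounds p2' p5' _ (a4.trans a5) a6
      have g2 := placeIn_bounds p2' p5' _ a7 (a8.trans a9)
      have g3 := placeIn_bounds p2' p5' _ (a7.trans a8) a9
      by_cases hP : P' = P
      · subst hP
        cases b with
        | true =>
          right
          refine ⟨fun h => by simpa using h.1, .inr (.inr ?_)⟩
          simp only [probe, box, Rect.placeIn]
          linarith
        | false =>
          rcases ih Q v with ⟨h, e1, e2, e3, e4⟩ | ⟨h, e⟩
          · left
            refine ⟨⟨rfl, rfl, h⟩, ?_⟩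
            have f1 := (placeIn_le p2 p5 _ _).1.2 e1
            have f2 := (placeIn_le p2 p5 _ _).1.2 e2
            simp only [probe, box, Rect.placeIn, (placeIn_le p2 p5 _ _).2]
            exact ⟨by linarith, f2 |>.trans' (by linarith), e3, e4⟩
          · right
            refine ⟨fun h' => h h'.2.2, ?_⟩
            simp only [probe, box, Rect.placeIn]
            rcases e with e | e | e
            · have f := lt_of_not_ge (mt (placeIn_le p2 p5 _ _).1.1 e.not_ge)
              left; linarith
            · have f := lt_of_not_ge (mt (placeIn_le p2 p5 _ _).1.1 e.not_ge)
              right; left; linarith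
            · have f := lt_of_not_ge (mt (placeIn_le p2 p5 _ _).2.1 e.not_ge)
              right; right; linarith
      · right
        refine ⟨fun h => hP h.2.1, ?_⟩
        rcases probe_disjoint k P' P hP with h | h
        · left; cases b <;> simp only [probe, box, Rect.placeIn] <;> linarith
        · right; left; cases b <;> simp only [probe, box, Rect.placeIn] <;> linarith
    · obtain ⟨p1', p2', p3', p4', p5', p6'⟩ := probe_bounds k P'
      obtain ⟨q1', q2', q3', q4', q5', q6'⟩ := probe_bounds k Q'
      have g0 := placeIn_bounds p2' p5' _ q1' (q2'.le.trans q3')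
      have g1 := placeIn_bounds p2' p5' _ (q1'.trans q2'.le) q3'
      have g4 := lt_of_not_ge (mt (placeIn_le p2' p5' _ _).1.1 q2'.not_ge)
      by_cases hP : P' = P
      · subst hP
        by_cases hQ : Q' = Q
        · subst hQ
          cases b with
          | true =>
            left
            refine ⟨⟨rfl, rfl, rfl⟩, ?_⟩
            simp only [probe, box, Rect.placeIn]
            refine ⟨le_rfl, le_rfl, ?_, le_rfl⟩
            linarith
          | false =>
            right
            refine ⟨fun h => by simpa using h.1, .inl ?_⟩
            simp only [probe, box, Rect.placeIn]
            linarith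
        · right
          refine ⟨fun h => hQ h.2.2, ?_⟩
          rcases probe_disjoint k Q' Q hQ with h | h
          · have f := lt_of_not_ge (mt (placeIn_le p2 p5 _ _).1.1 h.not_ge)
            left; cases b <;> simp only [probe, box, Rect.placeIn] <;> linarith
          · have f := lt_of_not_ge (mt (placeIn_le p2 p5 _ _).1.1 h.not_ge)
            right; left; cases b <;> simp only [probe, box, Rect.placeIn] <;> linarith
      · right
        refine ⟨fun h => hP h.2.1, ?_⟩
        rcases probe_disjoint k P' P hP with h | h
        · left; cases b <;> simp only [probe, box, Rect.placeIn] <;> linarith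
        · right; left; cases b <;> simp only [probe, box, Rect.placeIn] <;> linarith

/-- The graphs of the Burling sequence are the graphs with edge relation `AbstractAdj`. -/
theorem toSet_inter_nonempty_iff (k : ℕ) (u v : BoxIdx k) (huv : u ≠ v) :
    ((box k u).toSet ∩ (box k v).toSet).Nonempty ↔ AbstractAdj k u v := by
  have bd (k : ℕ) (v : BoxIdx k) : (box k v).x₀ ≤ (box k v).x₁ ∧ (box k v).y₀ ≤ (box k v).y₁ ∧
      (box k v).z₀ ≤ (box k v).z₁ :=
    ⟨(box_bounds k v).1.2.1, (box_bounds k v).2.1.2.1, (box_bounds k v).2.2.2.1⟩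
  rw [toSet_inter_nonempty (bd k u) (bd k v)]
  induction k with
  | zero => exact absurd (Subsingleton.elim (α := Unit) u v) huv
  | succ k ih =>
    have key (P : ProbeIdx k) (u : BoxIdx k) (P' Q : ProbeIdx k) :
        ((box k u).x₀ ≤ width k ∧ 0 ≤ (box k u).x₁) ∧
        (((probe k P).placeIn (box k u).toRect).y₀ ≤ (box (k + 1) (.inr (.inr (P', Q)))).y₁ ∧
          (box (k + 1) (.inr (.inr (P', Q)))).y₀ ≤ ((probe k P).placeIn (box k u).toRect).y₁) ∧
        (((probe k P).placeIn (box k u).toRect).z₀ ≤ (box (k + 1) (.inr (.inr (P', Q)))).z₁ ∧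
          (box (k + 1) (.inr (.inr (P', Q)))).z₀ ≤ ((probe k P).placeIn (box k u).toRect).z₁) ↔
        P = P' ∧ Stabs k Q u := by
      obtain ⟨⟨a1, a2, a3⟩, ⟨a4, a5, a6⟩, a7, a8, a9⟩ := box_bounds k u
      obtain ⟨p1, p2, p3, p4, p5, p6⟩ := probe_bounds k P
      obtain ⟨p1', p2', p3', p4', p5', p6'⟩ := probe_bounds k P'
      obtain ⟨q1, q2, q3, q4, q5, q6⟩ := probe_bounds k Q
      have g0 := placeIn_bounds p2 p5 _ a4 (a5.trans a6)
      have g1 := placeIn_bounds p2 p5 _ (a4.trans a5) a6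
      have g2 := placeIn_bounds p2 p5 _ a7 (a8.trans a9)
      have h0 := placeIn_bounds p2' p5' _ q1 (q2.le.trans q3)
      have h1 := placeIn_bounds p2' p5' _ (q1.trans q2.le) q3
      have h3 := placeIn_bounds p2' p5' _ (q4.trans q5.le) q6
      have h4 := lt_of_not_ge (mt (placeIn_le p2' p5' _ _).1.1 q2.not_ge)
      simp only [box, Rect.placeIn]
      by_cases hP : P = P'
      · subst hP
        rcases stabs_iff k Q u with ⟨h, e1, e2, e3, e4⟩ | ⟨h, e⟩
        · have f1 := (placeIn_le p2 p5 _ _).1.2 e1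
          have f2 := (placeIn_le p2 p5 _ _).1.2 e2
          have f4 := (placeIn_le p2 p5 _ _).2.2 e4
          simp only [h, and_self, iff_true]
          refine ⟨⟨?_, ?_⟩, ⟨?_, ?_⟩, ?_, ?_⟩ <;> linarith
        · simp only [h, and_false, iff_false]
          rintro ⟨-, ⟨c1, c2⟩, c3, c4⟩
          rcases e with e | e | e
          · have f := lt_of_not_ge (mt (placeIn_le p2 p5 _ _).1.1 e.not_ge)
            linarith
          · have f := lt_of_not_ge (mt (placeIn_le p2 p5 _ _).1.1 e.not_ge)
            linarith
          · have f := lt_of_not_ge (mt (placeIn_le p2 p5 _ _).2.1 e.not_ge)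
            have := lt_of_not_ge (mt (placeIn_le p2 p5 _ _).2.1 q5.not_ge)
            linarith
      · simp only [hP, false_and, iff_false]
        rintro ⟨-, ⟨c1, c2⟩, -⟩
        rcases probe_disjoint k P P' hP with h | h <;> linarith
    rcases u with u | ⟨P, u⟩ | ⟨P, Q⟩ <;> rcases v with v | ⟨P', v⟩ | ⟨P', Q'⟩
    · have := ih u v (fun h => huv (by rw [h]))
      simp only [AbstractAdj, ← this, box, add_le_add_iff_right]
    · simp only [AbstractAdj, iff_false, box]
      rintro ⟨h, -⟩
      linarith [(box_bounds k u).1.1, (box_bounds k v).1.2.2]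
    · simp only [AbstractAdj, iff_false, box]
      rintro ⟨h, -⟩
      linarith [(box_bounds k u).1.1]
    · simp only [AbstractAdj, iff_false, box]
      rintro ⟨h, -⟩
      linarith [(box_bounds k v).1.1, (box_bounds k u).1.2.2]
    · obtain ⟨p1, p2, p3, p4, p5, p6⟩ := probe_bounds k P
      by_cases hP : P = P'
      · subst hP
        have := ih u v (fun h => huv (by rw [h]))
        simp only [AbstractAdj, ← this, box, Rect.placeIn, (placeIn_le p2 p5 _ _).1,
          (placeIn_le p2 p5 _ _).2, true_and]
      · simp only [AbstractAdj, hP, false_and, iff_false, box, Rect.placeIn]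
        rintro ⟨-, h, -⟩
        obtain ⟨-, ⟨a4, a5, a6⟩, -⟩ := box_bounds k u
        obtain ⟨-, ⟨b4, b5, b6⟩, -⟩ := box_bounds k v
        obtain ⟨p1', p2', p3', p4', p5', p6'⟩ := probe_bounds k P'
        have g0 := placeIn_bounds p2 p5 _ a4 (a5.trans a6)
        have g1 := placeIn_bounds p2 p5 _ (a4.trans a5) a6
        have h0 := placeIn_bounds p2' p5' _ b4 (b5.trans b6)
        have h1 := placeIn_bounds p2' p5' _ (b4.trans b5) b6
        rcases probe_disjoint k P P' hP with h | h <;> linarith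
    · exact key P u P' Q'
    · simp only [AbstractAdj, iff_false, box]
      rintro ⟨h, -⟩
      linarith [(box_bounds k v).1.1]
    · rw [AbstractAdj, ← key P' v P Q]
      simp only [box]
      tauto
    · simp only [AbstractAdj, iff_false, box, Rect.placeIn]
      rintro ⟨-, h, -⟩
      obtain ⟨p1, p2, p3, p4, p5, p6⟩ := probe_bounds k P
      obtain ⟨q1, q2, q3, q4, q5, q6⟩ := probe_bounds k Q
      obtain ⟨p1', p2', p3', p4', p5', p6'⟩ := probe_bounds k P'
      obtain ⟨q1', q2', q3', q4', q5', q6'⟩ := probe_bounds k Q'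
      have h0 := placeIn_bounds p2 p5 _ q1 (q2.le.trans q3)
      have h1 := placeIn_bounds p2 p5 _ (q1.trans q2.le) q3
      have h0' := placeIn_bounds p2' p5' _ q1' (q2'.le.trans q3')
      have h1' := placeIn_bounds p2' p5' _ (q1'.trans q2'.le) q3'
      have h4 := lt_of_not_ge (mt (placeIn_le p2 p5 _ _).1.1 q2.not_ge)
      have h4' := lt_of_not_ge (mt (placeIn_le p2' p5' _ _).1.1 q2'.not_ge)
      by_cases hP : P = P'
      · subst hP
        have hQ : Q ≠ Q' := fun h => huv (by rw [h])
        rcases probe_disjoint k Q Q' hQ with e | e <;>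
        · have f := lt_of_not_ge (mt (placeIn_le p2 p5 _ _).1.1 e.not_ge)
          linarith
      · rcases probe_disjoint k P P' hP with h | h <;> linarith

theorem burlingSequence_adj (k : ℕ) (u v : BoxIdx k) :
    (burlingSequence k).Adj u v ↔ u ≠ v ∧ AbstractAdj k u v :=
  and_congr_right fun h => toSet_inter_nonempty_iff k u v h

end Burling

/-! ### Burling trees -/

/-- A rooted tree. -/
structure TreeWithRoot (V : Type) where
  tree : SimpleGraph V
  isTree : tree.IsTree
  root : V

namespace TreeWithRoot

variable {V : Type} (T : TreeWithRoot V)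

/-- `u` lies on the path from `v` to the root. -/
def IsAncestor (u v : V) : Prop := ∃ p : T.tree.Walk v T.root, p.IsPath ∧ u ∈ p.support

/-- `u` is the parent of `v` (and `v` a child of `u`): the neighbor of `v` on the path from `v` to
the root. -/
def IsParent (u v : V) : Prop := T.tree.Adj u v ∧ T.IsAncestor u v

/-- A leaf of a rooted tree is a vertex without children. -/
def IsLeaf (v : V) : Prop := ∀ w, ¬ T.IsParent v w

/-- A (possibly empty) branch, as the list of its vertices. -/
def IsBranch (B : List V) : Prop := B.IsChain T.IsParent

/-- A branch that starts at the root and ends at a leaf. -/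
def IsPrincipalBranch (B : List V) : Prop :=
  T.IsBranch B ∧ B.head? = some T.root ∧ ∃ v, B.getLast? = some v ∧ T.IsLeaf v

end TreeWithRoot

/-- Burling trees. The value of `lastBorn` at leaves is irrelevant. -/
structure BurlingTree (V : Type) extends TreeWithRoot V where
  /-- the last-born child of a non-leaf vertex -/
  lastBorn : V → V
  isParent_lastBorn : ∀ u, ¬ toTreeWithRoot.IsLeaf u → toTreeWithRoot.IsParent u (lastBorn u)
  /-- the choose function -/
  choose : V → Set V
  /-- for a vertex `v` with parent `u` that is not last-born, `choose v` is the vertex set of an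
  empty branch or of a branch starting at the last-born of `u` -/
  choose_of_ne_lastBorn : ∀ u v, toTreeWithRoot.IsParent u v → v ≠ lastBorn u →
    ∃ B : List V, toTreeWithRoot.IsBranch B ∧ (B = [] ∨ B.head? = some (lastBorn u)) ∧
      choose v = {w | w ∈ B}
  choose_lastBorn : ∀ u, ¬ toTreeWithRoot.IsLeaf u → choose (lastBorn u) = ∅
  choose_root : choose root = ∅

namespace BurlingTree

variable {V : Type} (T : BurlingTree V)

/-- The graph fully derived from `T`, underlying the oriented graph with an arc from `u` to each
vertex of `choose u`. -/
def derivedGraph : SimpleGraph V := SimpleGraph.fromRel fun u v => v ∈ T.choose u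

/-- The graph obtained from the derived graph by making every principal branch a clique. -/
def chordalGraph : SimpleGraph V :=
  T.derivedGraph ⊔ SimpleGraph.fromRel fun u v => ∃ B, T.IsPrincipalBranch B ∧ u ∈ B ∧ v ∈ B

end BurlingTree

/-- Burling strongly chordal graphs: the closure under induced subgraphs (and isomorphism) of the
class of the graphs `T.chordalGraph`, for `T` a finite Burling tree. -/
def burlingStronglyChordalGraphs : Set FinGraph :=
  {G | ∃ (V : Type) (_ : Finite V) (T : BurlingTree V), Nonempty (G.graph ↪g T.chordalGraph)}

/-!
A vertex of a Burling tree is *simple* in an induced subgraph of the chordal graph of the tree if it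
comes first in a postorder that visits last-born children last: its neighbors then lie on a single
branch, and closed neighborhoods shrink along branches. A simple vertex of a cycle yields the
chords that strong chordality asks for. The inclusion is proper because a clique is a chain in the
ancestor order up to one vertex, so that in a path on four vertices inflated to triangles some four
consecutive vertices would be connected by ancestor relations, which forces a chord.

For the intersection, the arcs of a Burling tree go from `u` to vertices below the last-born sibling
of `u`. The relation *below the last-born sibling*, completed by an arbitrary linear order among the
siblings that are not last-born, is a forest order, so its comparability graph is trivially
perfect; it relates no two vertices of a common branch, hence intersecting with it deletes exactly
the edges added by making branches cliques. The boxes of the Burling sequence form a Burling tree in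
which the probes are the principal branches: the boxes of the small copy inside the column of `P`
and the boxes added for `P` hang below the last vertex of the branch of `P`, and the box added for
the pair `P, Q` chooses the branch of `Q` in that copy.
-/

/-! ### The ancestor order of a rooted tree -/

namespace TreeWithRoot

variable {V : Type} {T : TreeWithRoot V} {B : List V} {a p u v w x : V}

theorem isParent_iff_exists_isPath_cons :
    T.IsParent p v ↔ ∃ (h : T.tree.Adj v p) (q : T.tree.Walk p T.root), (q.cons h).IsPath := by
  classical
  constructor
  · rintro ⟨h, q, hq, hp⟩
    have edge_isPath : (SimpleGraph.Walk.cons h.symm (.nil : T.tree.Walk p p)).IsPath := by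
      simp [SimpleGraph.Walk.cons_isPath_iff, h.ne']
    have takeUntil_eq := (T.isTree.existsUnique_path v p).unique (hq.takeUntil hp) edge_isPath
    have eq_cons : (q.dropUntil p hp).cons h.symm = q := by
      conv_rhs => rw [← q.take_spec hp, takeUntil_eq]
      rfl
    exact ⟨h.symm, q.dropUntil p hp, eq_cons.symm ▸ hq⟩
  · rintro ⟨h, q, hq⟩
    exact ⟨h.symm, _, hq, by simp⟩

theorem isAncestor_iff_mem_support {q : T.tree.Walk v T.root} (hq : q.IsPath) :
    T.IsAncestor u v ↔ u ∈ q.support := by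
  refine ⟨fun ⟨q', hq', hu⟩ => ?_, fun hu => ⟨q, hq, hu⟩⟩
  rwa [(T.isTree.existsUnique_path v T.root).unique hq hq']

theorem IsParent.unique (hu : T.IsParent u w) (hv : T.IsParent v w) : u = v := by
  obtain ⟨hu, q, hq⟩ := isParent_iff_exists_isPath_cons.1 hu
  obtain ⟨hv, q', hq'⟩ := isParent_iff_exists_isPath_cons.1 hv
  have := (T.isTree.existsUnique_path w T.root).unique hq hq'
  simp only [SimpleGraph.Walk.cons.injEq] at this
  exact this.1

theorem IsParent.ne_root (hp : T.IsParent p v) : v ≠ T.root := by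
  rintro rfl
  obtain ⟨h, q, hq⟩ := isParent_iff_exists_isPath_cons.1 hp
  exact ((SimpleGraph.Walk.cons_isPath_iff h q).1 hq).2 q.end_mem_support

theorem IsParent.isAncestor_iff (hp : T.IsParent p v) :
    T.IsAncestor u v ↔ u = v ∨ T.IsAncestor u p := by
  obtain ⟨h, q, hq⟩ := isParent_iff_exists_isPath_cons.1 hp
  rw [isAncestor_iff_mem_support hq, isAncestor_iff_mem_support hq.of_cons,
    SimpleGraph.Walk.support_cons, List.mem_cons]

theorem IsParent.not_isAncestor (hp : T.IsParent p v) : ¬ T.IsAncestor v p := by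
  obtain ⟨h, q, hq⟩ := isParent_iff_exists_isPath_cons.1 hp
  rw [isAncestor_iff_mem_support hq.of_cons]
  exact ((SimpleGraph.Walk.cons_isPath_iff h q).1 hq).2

theorem isAncestor_root_iff : T.IsAncestor u T.root ↔ u = T.root := by
  rw [isAncestor_iff_mem_support SimpleGraph.Walk.IsPath.nil, SimpleGraph.Walk.support_nil,
    List.mem_singleton]

theorem vertex_induction {motive : V → Prop} (root : motive T.root)
    (child : ∀ p v, T.IsParent p v → motive p → motive v) (v : V) : motive v := by
  obtain ⟨q, hq, -⟩ := T.isTree.existsUnique_path v T.root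
  suffices ∀ (u w : V) (q : T.tree.Walk u w), q.IsPath → w = T.root → motive u from
    this v T.root q hq rfl
  intro u w q hq hw
  induction q with
  | nil => exact hw ▸ root
  | cons h q ih =>
    subst hw
    exact child _ _ (isParent_iff_exists_isPath_cons.2 ⟨h, q, hq⟩) (ih hq.of_cons rfl)

theorem exists_isParent_of_ne_root (hv : v ≠ T.root) : ∃ p, T.IsParent p v := by
  induction v using T.vertex_induction with
  | root => exact absurd rfl hv
  | child p v hp _ => exact ⟨p, hp⟩

theorem isAncestor_iff_reflTransGen :
    T.IsAncestor u v ↔ Relation.ReflTransGen T.IsParent u v := by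
  induction v using T.vertex_induction with
  | root =>
    rw [isAncestor_root_iff, Relation.ReflTransGen.cases_tail_iff]
    exact ⟨fun h => .inl h.symm, fun h => h.elim Eq.symm fun ⟨p, _, hp⟩ => (hp.ne_root rfl).elim⟩
  | child p v hp ih =>
    rw [hp.isAncestor_iff, ih, Relation.ReflTransGen.cases_tail_iff _ u v, eq_comm]
    refine or_congr_right ⟨fun h => ⟨p, h, hp⟩, fun ⟨q, h, hq⟩ => ?_⟩
    rwa [hp.unique hq]

theorem IsAncestor.refl (v : V) : T.IsAncestor v v :=
  isAncestor_iff_reflTransGen.2 .refl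

theorem root_isAncestor (v : V) : T.IsAncestor T.root v := by
  induction v using T.vertex_induction with
  | root => exact .refl _
  | child p v hp ih => exact hp.isAncestor_iff.2 (.inr ih)

theorem IsParent.isAncestor (hp : T.IsParent p v) : T.IsAncestor p v := hp.2

theorem IsAncestor.trans (huv : T.IsAncestor u v) (hvw : T.IsAncestor v w) : T.IsAncestor u w := by
  rw [isAncestor_iff_reflTransGen] at *
  exact Relation.ReflTransGen.trans huv hvw

theorem IsAncestor.of_isParent (hu : T.IsAncestor u w) (hp : T.IsParent p w) (hne : u ≠ w) :
    T.IsAncestor u p :=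
  (hp.isAncestor_iff.1 hu).resolve_left hne

theorem IsAncestor.antisymm (huv : T.IsAncestor u v) (hvu : T.IsAncestor v u) : u = v := by
  rcases (Relation.ReflTransGen.cases_tail_iff _ _ _).1 (isAncestor_iff_reflTransGen.1 huv) with
    rfl | ⟨p, hup, hp⟩
  · rfl
  · exact absurd (hvu.trans (isAncestor_iff_reflTransGen.2 hup)) hp.not_isAncestor

theorem IsAncestor.total (hu : T.IsAncestor u w) (hv : T.IsAncestor v w) :
    T.IsAncestor u v ∨ T.IsAncestor v u := by
  induction w using T.vertex_induction with
  | root => exact .inl (isAncestor_root_iff.1 hu ▸ T.root_isAncestor v)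
  | child p w hp ih =>
    rcases hp.isAncestor_iff.1 hu with rfl | hup
    · exact .inr hv
    rcases hp.isAncestor_iff.1 hv with rfl | hvp
    · exact .inl hu
    · exact ih hup hvp

theorem IsParent.eq_of_isAncestor (hu : T.IsParent p u) (hv : T.IsParent p v)
    (huw : T.IsAncestor u w) (hvw : T.IsAncestor v w) : u = v := by
  by_contra hne
  rcases huw.total hvw with h | h
  · exact hu.not_isAncestor (h.of_isParent hv hne)
  · exact hv.not_isAncestor (h.of_isParent hu (Ne.symm hne))

/-- The vertices of a rooted tree ordered by ancestry, with the root as least element. -/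
abbrev ancestorOrder (T : TreeWithRoot V) : PartialOrder V where
  le := T.IsAncestor
  le_refl := .refl
  le_trans _ _ _ := .trans
  le_antisymm _ _ := IsAncestor.antisymm

theorem exists_isLeaf_isAncestor [Finite V] (v : V) : ∃ w, T.IsLeaf w ∧ T.IsAncestor v w := by
  let := T.ancestorOrder
  obtain ⟨w, hvw, hw⟩ := Finite.exists_le_maximal (p := fun _ : V => True) (a := v) trivial
  exact ⟨w, fun x hx => hx.not_isAncestor (hw.2 trivial hx.isAncestor), hvw⟩

theorem IsBranch.pairwise_isAncestor (hB : T.IsBranch B) : B.Pairwise T.IsAncestor :=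
  haveI : Trans T.IsAncestor T.IsAncestor T.IsAncestor := ⟨.trans⟩
  (List.IsChain.imp (fun _ _ => IsParent.isAncestor) hB).pairwise

theorem IsBranch.total (hB : T.IsBranch B) (hu : u ∈ B) (hv : v ∈ B) :
    T.IsAncestor u v ∨ T.IsAncestor v u := by
  have : Std.Symm fun u v => T.IsAncestor u v ∨ T.IsAncestor v u := ⟨fun _ _ => .symm⟩
  exact List.Pairwise.forall_of_forall (R := fun u v => T.IsAncestor u v ∨ T.IsAncestor v u)
    (fun x _ => .inl (.refl x)) (hB.pairwise_isAncestor.imp .inl) hu hv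

theorem IsBranch.head_isAncestor (hB : T.IsBranch (a :: B)) (hw : w ∈ a :: B) :
    T.IsAncestor a w := by
  rcases List.mem_cons.1 hw with rfl | hw
  · exact .refl _
  · exact (List.pairwise_cons.1 hB.pairwise_isAncestor).1 w hw

theorem IsBranch.mem_of_isAncestor (hB : T.IsBranch (a :: B)) (hw : w ∈ a :: B)
    (hax : T.IsAncestor a x) (hxw : T.IsAncestor x w) : x ∈ a :: B := by
  induction B generalizing a with
  | nil =>
    obtain rfl := List.mem_singleton.1 hw
    exact List.mem_singleton.2 (hxw.antisymm hax)
  | cons b B ih =>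
    obtain ⟨hab, hB⟩ := List.isChain_cons_cons.1 hB
    rcases List.mem_cons.1 hw with rfl | hw
    · exact hxw.antisymm hax ▸ List.mem_cons_self
    by_cases hbx : T.IsAncestor b x
    · exact List.mem_cons_of_mem _ (ih hB hw hbx)
    · have hxb := (hxw.total (IsBranch.head_isAncestor hB hw)).resolve_right hbx
      have hxa := hxb.of_isParent hab fun h => hbx (h ▸ .refl x)
      exact hxa.antisymm hax ▸ List.mem_cons_self

theorem exists_isPrincipalBranch_of_isAncestor [Finite V] (huv : T.IsAncestor u v) :
    ∃ B, T.IsPrincipalBranch B ∧ u ∈ B ∧ v ∈ B := by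
  obtain ⟨w, hw, hvw⟩ := exists_isLeaf_isAncestor (T := T) v
  obtain ⟨B, hB, hlast⟩ := List.exists_isChain_cons_of_relationReflTransGen
    (isAncestor_iff_reflTransGen.1 (T.root_isAncestor w))
  have hmem : w ∈ T.root :: B := hlast ▸ List.getLast_mem _
  refine ⟨T.root :: B, ⟨hB, rfl, w, ?_, hw⟩,
    IsBranch.mem_of_isAncestor hB hmem (T.root_isAncestor u) (huv.trans hvw),
    IsBranch.mem_of_isAncestor hB hmem (T.root_isAncestor v) hvw⟩
  rw [List.getLast?_eq_getLast_of_ne_nil (List.cons_ne_nil _ _), hlast]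

theorem exists_isPrincipalBranch_iff [Finite V] :
    (∃ B, T.IsPrincipalBranch B ∧ u ∈ B ∧ v ∈ B) ↔ T.IsAncestor u v ∨ T.IsAncestor v u := by
  refine ⟨fun ⟨B, hB, hu, hv⟩ => hB.1.total hu hv, fun h => ?_⟩
  rcases h with h | h
  · exact exists_isPrincipalBranch_of_isAncestor h
  · obtain ⟨B, hB, hv, hu⟩ := exists_isPrincipalBranch_of_isAncestor h
    exact ⟨B, hB, hu, hv⟩

end TreeWithRoot

/-! ### Simple vertices -/

/-- The closed neighborhood of a vertex. -/
def closedNeighborSet {V : Type*} (G : SimpleGraph V) (v : V) : Set V :=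
  insert v (G.neighborSet v)

/-- A vertex `v` is simple in the subgraph of `G` induced by `s` if the closed neighborhoods of its
neighbors are linearly ordered by inclusion. -/
def IsSimpleIn {V : Type*} (G : SimpleGraph V) (s : Set V) (v : V) : Prop :=
  ∀ x ∈ s, ∀ y ∈ s, G.Adj v x → G.Adj v y →
    closedNeighborSet G x ∩ s ⊆ closedNeighborSet G y ∨
      closedNeighborSet G y ∩ s ⊆ closedNeighborSet G x

/-- Every non-null induced subgraph has a simple vertex. Farber showed that this characterizes the
finite strongly chordal graphs. -/
def HasSimpleVertices {V : Type*} (G : SimpleGraph V) : Prop :=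
  ∀ s : Set V, s.Nonempty → ∃ v ∈ s, IsSimpleIn G s v

theorem mem_closedNeighborSet {V : Type*} {G : SimpleGraph V} {v w : V} :
    w ∈ closedNeighborSet G v ↔ w = v ∨ G.Adj v w :=
  Iff.rfl

/-! ### Chosen vertices of a Burling tree -/

namespace BurlingTree

variable {V : Type} {T : BurlingTree V} {q u v w x : V}

theorem isParent_lastBorn_of_isParent (hq : T.IsParent q u) : T.IsParent q (T.lastBorn q) :=
  T.isParent_lastBorn q fun hleaf => hleaf u hq

/-- The vertex `v` lies below the last-born sibling of `u`, and `u` is not last-born itself: these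
are the vertices that may be chosen by `u`. -/
def MayChoose (T : BurlingTree V) (u v : V) : Prop :=
  ∃ q, T.IsParent q u ∧ u ≠ T.lastBorn q ∧ T.IsAncestor (T.lastBorn q) v

theorem MayChoose.not_isAncestor_left (huv : T.MayChoose u v) : ¬ T.IsAncestor u v := by
  obtain ⟨q, hq, hne, hv⟩ := huv
  exact fun h => hne (hq.eq_of_isAncestor (isParent_lastBorn_of_isParent hq) h hv)

theorem MayChoose.not_isAncestor_right (huv : T.MayChoose u v) : ¬ T.IsAncestor v u := by
  obtain ⟨q, hq, hne, hv⟩ := huv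
  exact fun h =>
    hne (hq.eq_of_isAncestor (isParent_lastBorn_of_isParent hq) (.refl u) (hv.trans h))

theorem MayChoose.isAncestor_of_ne (huv : T.MayChoose u v) (hwu : T.IsAncestor w u)
    (hne : w ≠ u) : T.IsAncestor w v := by
  obtain ⟨q, hq, -, hv⟩ := huv
  exact (hwu.of_isParent hq hne).trans ((isParent_lastBorn_of_isParent hq).isAncestor.trans hv)

theorem MayChoose.mayChoose_or_isAncestor (huv : T.MayChoose u v) (hwv : T.IsAncestor w v) :
    T.MayChoose u w ∨ T.IsAncestor w u ∧ w ≠ u := by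
  have hne_left : w ≠ u := fun h => huv.not_isAncestor_left (h ▸ hwv)
  obtain ⟨q, hq, hne, hv⟩ := huv
  by_cases hw : T.IsAncestor (T.lastBorn q) w
  · exact .inl ⟨q, hq, hne, hw⟩
  · have hwq := ((hv.total hwv).resolve_left hw).of_isParent (isParent_lastBorn_of_isParent hq)
      fun h => hw (h ▸ .refl w)
    exact .inr ⟨hwq.trans hq.isAncestor, hne_left⟩

theorem MayChoose.trans (huv : T.MayChoose u v) (hvw : T.MayChoose v w) : T.MayChoose u w := by
  obtain ⟨q, hq, hu, hqv⟩ := huv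
  obtain ⟨r, hr, hv, hrw⟩ := hvw
  have hne : T.lastBorn q ≠ v := by
    rintro rfl
    exact hv (by rw [hr.unique (isParent_lastBorn_of_isParent hq)])
  exact ⟨q, hq, hu, ((hqv.of_isParent hr hne).trans
    (isParent_lastBorn_of_isParent hr).isAncestor).trans hrw⟩

theorem exists_branch_of_mem_choose (hv : v ∈ T.choose u) :
    ∃ q B, T.IsParent q u ∧ u ≠ T.lastBorn q ∧ T.IsBranch (T.lastBorn q :: B) ∧
      T.choose u = {w | w ∈ T.lastBorn q :: B} := by
  have hroot : u ≠ T.root := by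
    rintro rfl
    simp only [T.choose_root, Set.mem_empty_iff_false] at hv
  obtain ⟨q, hq⟩ := TreeWithRoot.exists_isParent_of_ne_root hroot
  have hne : u ≠ T.lastBorn q := by
    rintro rfl
    simp only [T.choose_lastBorn q fun h => h _ hq, Set.mem_empty_iff_false] at hv
  obtain ⟨B, hB, rfl | hhead, hchoose⟩ := T.choose_of_ne_lastBorn q u hq hne
  · simp [hchoose] at hv
  · obtain ⟨B, rfl⟩ := List.head?_eq_some_iff.1 hhead
    exact ⟨q, B, hq, hne, hB, hchoose⟩

theorem mayChoose_of_mem_choose (hv : v ∈ T.choose u) : T.MayChoose u v := by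
  obtain ⟨q, B, hq, hne, hB, hchoose⟩ := exists_branch_of_mem_choose hv
  rw [hchoose] at hv
  exact ⟨q, hq, hne, hB.head_isAncestor hv⟩

theorem isAncestor_total_of_mem_choose (hv : v ∈ T.choose u) (hw : w ∈ T.choose u) :
    T.IsAncestor v w ∨ T.IsAncestor w v := by
  obtain ⟨q, B, -, -, hB, hchoose⟩ := exists_branch_of_mem_choose hv
  rw [hchoose] at hv hw
  exact hB.total hv hw

theorem mem_choose_of_isAncestor (hw : w ∈ T.choose u) (huv : T.MayChoose u v)
    (hvw : T.IsAncestor v w) : v ∈ T.choose u := by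
  obtain ⟨q, B, hq, -, hB, hchoose⟩ := exists_branch_of_mem_choose hw
  obtain ⟨r, hr, -, hrv⟩ := huv
  rw [hchoose] at hw ⊢
  exact hB.mem_of_isAncestor hw (hq.unique hr ▸ hrv) hvw

theorem chordalGraph_adj [Finite V] : T.chordalGraph.Adj u v ↔
    u ≠ v ∧ (v ∈ T.choose u ∨ u ∈ T.choose v ∨ T.IsAncestor u v ∨ T.IsAncestor v u) := by
  simp only [chordalGraph, derivedGraph, SimpleGraph.sup_adj, SimpleGraph.fromRel_adj,
    TreeWithRoot.exists_isPrincipalBranch_iff]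
  tauto

/-! ### Burling strongly chordal graphs have simple vertices -/

/-- The order in which a depth-first search that visits last-born children last leaves the
vertices, up to the order of siblings that are not last-born. -/
def PostorderLT (T : BurlingTree V) (u v : V) : Prop :=
  (T.IsAncestor v u ∧ v ≠ u) ∨ ∃ c, T.IsAncestor c u ∧ T.MayChoose c v

theorem PostorderLT.irrefl (v : V) : ¬ T.PostorderLT v v := by
  rintro (h | ⟨c, hc, hcv⟩)
  · exact h.2 rfl
  · exact hcv.not_isAncestor_left hc

theorem PostorderLT.trans (huv : T.PostorderLT u v) (hvw : T.PostorderLT v w) :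
    T.PostorderLT u w := by
  rcases huv with ⟨hvu, hne⟩ | ⟨c, hcu, hcv⟩ <;> rcases hvw with ⟨hwv, -⟩ | ⟨d, hdv, hdw⟩
  · exact .inl ⟨hwv.trans hvu, fun h => hne (hvu.antisymm (h ▸ hwv))⟩
  · exact .inr ⟨d, hdv.trans hvu, hdw⟩
  · rcases hcv.mayChoose_or_isAncestor hwv with hcw | ⟨hwc, hwc_ne⟩
    · exact .inr ⟨c, hcu, hcw⟩
    · exact .inl ⟨hwc.trans hcu, fun h => hwc_ne (hwc.antisymm (h ▸ hcu))⟩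
  · rcases hcv.mayChoose_or_isAncestor hdv with hcd | ⟨hdc, -⟩
    · exact .inr ⟨c, hcu, hcd.trans hdw⟩
    · exact .inr ⟨d, hdc.trans hcu, hdw⟩

theorem exists_lowest_notMem_choose [Finite V] (T : BurlingTree V) {s : Set V} (hs : s.Nonempty) :
    ∃ v ∈ s, (∀ w ∈ s, T.IsAncestor v w → w = v) ∧ ∀ u ∈ s, v ∉ T.choose u := by
  have : IsStrictOrder V T.PostorderLT :=
    { irrefl := PostorderLT.irrefl, trans := fun _ _ _ => PostorderLT.trans }
  obtain ⟨v, hv, hmin⟩ := (Finite.wellFounded_of_trans_of_irrefl T.PostorderLT).has_min s hs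
  refine ⟨v, hv, fun w hw hvw => ?_, fun u hu hvu => ?_⟩
  · by_contra hne
    exact hmin w hw (.inl ⟨hvw, Ne.symm hne⟩)
  · exact hmin u hu (.inr ⟨u, .refl u, mayChoose_of_mem_choose hvu⟩)

theorem exists_neighbors_chain [Finite V] (T : BurlingTree V) {s : Set V} (hs : s.Nonempty) :
    ∃ v ∈ s, ∀ x ∈ s, ∀ y ∈ s, T.chordalGraph.Adj v x → T.chordalGraph.Adj v y →
      T.IsAncestor x y ∨ T.IsAncestor y x := by
  obtain ⟨v, hv, hlow, hchosen⟩ := T.exists_lowest_notMem_choose hs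
  have mem_choose_or_isAncestor : ∀ x ∈ s, T.chordalGraph.Adj v x →
      x ∈ T.choose v ∨ T.IsAncestor x v ∧ x ≠ v := by
    intro x hx hvx
    obtain ⟨hne, h | h | h | h⟩ := chordalGraph_adj.1 hvx
    · exact .inl h
    · exact absurd h (hchosen x hx)
    · exact absurd (hlow x hx h).symm hne
    · exact .inr ⟨h, hne.symm⟩
  refine ⟨v, hv, fun x hx y hy hvx hvy => ?_⟩
  rcases mem_choose_or_isAncestor x hx hvx with hx | ⟨hx, hxv⟩ <;>
    rcases mem_choose_or_isAncestor y hy hvy with hy | ⟨hy, hyv⟩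
  · exact isAncestor_total_of_mem_choose hx hy
  · exact .inr ((mayChoose_of_mem_choose hx).isAncestor_of_ne hy hyv)
  · exact .inl ((mayChoose_of_mem_choose hy).isAncestor_of_ne hx hxv)
  · exact hx.total hy

theorem closedNeighborSet_subset_of_isAncestor [Finite V] (hxv : T.IsAncestor x v) :
    closedNeighborSet T.chordalGraph v ⊆ closedNeighborSet T.chordalGraph x := by
  intro w hw
  rcases eq_or_ne w x with rfl | hwx
  · exact .inl rfl
  rcases eq_or_ne x v with rfl | hne
  · exact hw
  refine .inr (chordalGraph_adj.2 ⟨hwx.symm, ?_⟩)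
  rcases hw with rfl | hw
  · exact .inr (.inr (.inl hxv))
  obtain ⟨-, h | h | h | h⟩ := chordalGraph_adj.1 hw
  · exact .inr (.inr (.inl ((mayChoose_of_mem_choose h).isAncestor_of_ne hxv hne)))
  · rcases (mayChoose_of_mem_choose h).mayChoose_or_isAncestor hxv with hwx | ⟨hxw, -⟩
    · exact .inr (.inl (mem_choose_of_isAncestor h hwx hxv))
    · exact .inr (.inr (.inl hxw))
  · exact .inr (.inr (.inl (hxv.trans h)))
  · exact .inr (.inr (hxv.total h))

theorem hasSimpleVertices_chordalGraph [Finite V] (T : BurlingTree V) :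
    HasSimpleVertices T.chordalGraph := by
  intro s hs
  obtain ⟨v, hv, hchain⟩ := T.exists_neighbors_chain hs
  refine ⟨v, hv, fun x hx y hy hvx hvy => (hchain x hx y hy hvx hvy).symm.imp ?_ ?_⟩ <;>
  exact fun h => Set.inter_subset_left.trans (closedNeighborSet_subset_of_isAncestor h)

end BurlingTree

/-! ### Strong chordality from simple vertices -/

theorem HasSimpleVertices.comap {V W : Type*} {G : SimpleGraph V} {H : SimpleGraph W}
    (hG : HasSimpleVertices G) (f : H ↪g G) : HasSimpleVertices H := by
  intro s hs
  obtain ⟨_, ⟨v, hv, rfl⟩, hsimple⟩ := hG (f '' s) (hs.image f)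
  have mem_closedNeighborSet_map (x z : W) :
      f z ∈ closedNeighborSet G (f x) ↔ z ∈ closedNeighborSet H x := by
    simp only [mem_closedNeighborSet, f.map_adj_iff, f.injective.eq_iff]
  have subset_of_map_subset {x y : W} (h : closedNeighborSet G (f x) ∩ f '' s ⊆
      closedNeighborSet G (f y)) : closedNeighborSet H x ∩ s ⊆ closedNeighborSet H y :=
    fun z hz => (mem_closedNeighborSet_map y z).1
      (h ⟨(mem_closedNeighborSet_map x z).2 hz.1, Set.mem_image_of_mem f hz.2⟩)
  exact ⟨v, hv, fun x hx y hy hvx hvy => (hsimple _ (Set.mem_image_of_mem f hx) _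
    (Set.mem_image_of_mem f hy) (f.map_adj_iff.2 hvx) (f.map_adj_iff.2 hvy)).imp
    subset_of_map_subset subset_of_map_subset⟩

theorem cycleGraph_adj_iff_val {n : ℕ} (hn : 2 ≤ n) {u v : Fin n} :
    (SimpleGraph.cycleGraph n).Adj u v ↔ u.val + 1 = v.val ∨ v.val + 1 = u.val ∨
      (u.val = 0 ∧ v.val + 1 = n) ∨ (v.val = 0 ∧ u.val + 1 = n) := by
  have sub_val_eq_one (u v : Fin n) :
      (u - v).val = 1 ↔ v.val + 1 = u.val ∨ u.val = 0 ∧ v.val + 1 = n := by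
    rcases le_or_gt v u with h | h
    · rw [Fin.sub_val_of_le h]
      have := Fin.le_def.1 h
      omega
    · rw [Fin.coe_sub_iff_lt.2 h]
      have := Fin.lt_def.1 h
      omega
  rw [SimpleGraph.cycleGraph_adj', sub_val_eq_one, sub_val_eq_one]
  tauto

theorem cycleGraph_not_adj_of_adj_of_adj {n : ℕ} (hn : 4 ≤ n) {u v w : Fin n}
    (huv : (SimpleGraph.cycleGraph n).Adj u v) (hvw : (SimpleGraph.cycleGraph n).Adj v w) :
    ¬ (SimpleGraph.cycleGraph n).Adj u w := by
  rw [cycleGraph_adj_iff_val (by omega)] at *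
  omega

theorem cycleGraph_not_adj_of_path {n : ℕ} (hn : 5 ≤ n) {t u v w : Fin n}
    (htu : (SimpleGraph.cycleGraph n).Adj t u) (huv : (SimpleGraph.cycleGraph n).Adj u v)
    (hvw : (SimpleGraph.cycleGraph n).Adj v w) (htv : t ≠ v) (huw : u ≠ w) :
    ¬ (SimpleGraph.cycleGraph n).Adj t w := by
  rw [cycleGraph_adj_iff_val (by omega)] at *
  rw [Ne, Fin.ext_iff] at htv huw
  omega

theorem cycleGraph_val_mod_two_ne {n : ℕ} (hn : Even n) {u v : Fin n}
    (huv : (SimpleGraph.cycleGraph n).Adj u v) : u.val % 2 ≠ v.val % 2 := by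
  intro h
  refine (SimpleGraph.cycleGraph.bicoloring_of_even n hn).valid huv ?_
  change decide (u.val % 2 = 0) = decide (v.val % 2 = 0)
  rw [h]

theorem exists_cycleGraph_adj_ne {n : ℕ} (hn : 3 ≤ n) (u v : Fin n) :
    ∃ w, (SimpleGraph.cycleGraph n).Adj v w ∧ w ≠ u := by
  obtain ⟨n, rfl⟩ := Nat.exists_eq_add_of_le' hn
  have one_lt_degree : 1 < ((SimpleGraph.cycleGraph (n + 3)).neighborFinset v).card := by
    rw [SimpleGraph.card_neighborFinset_eq_degree, SimpleGraph.cycleGraph_degree_three_le]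
    exact Nat.one_lt_two
  obtain ⟨w, hw, hne⟩ := Finset.exists_mem_ne one_lt_degree u
  exact ⟨w, (SimpleGraph.mem_neighborFinset _ _ _).1 hw, hne⟩

theorem HasSimpleVertices.exists_closedNeighborSet_subset_of_copy {V : Type*} {G : SimpleGraph V}
    (hG : HasSimpleVertices G) {n : ℕ} (hn : 3 ≤ n)
    (f : SimpleGraph.Copy (SimpleGraph.cycleGraph n) G) :
    ∃ u v w, (SimpleGraph.cycleGraph n).Adj u v ∧ (SimpleGraph.cycleGraph n).Adj v w ∧ u ≠ w ∧
      closedNeighborSet G (f u) ∩ Set.range f ⊆ closedNeighborSet G (f w) := by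
  obtain ⟨_, ⟨v, rfl⟩, hv⟩ := hG (Set.range f) ⟨_, ⟨0, by omega⟩, rfl⟩
  obtain ⟨u, hvu, -⟩ := exists_cycleGraph_adj_ne hn v v
  obtain ⟨w, hvw, hne⟩ := exists_cycleGraph_adj_ne hn u v
  rcases hv (f u) ⟨u, rfl⟩ (f w) ⟨w, rfl⟩ (f.toHom.map_adj hvu) (f.toHom.map_adj hvw) with h | h
  · exact ⟨u, v, w, hvu.symm, hvw, hne.symm, h⟩
  · exact ⟨w, v, u, hvw.symm, hvu, hne, h⟩

theorem HasSimpleVertices.isChordal {V : Type} {G : SimpleGraph V} (hG : HasSimpleVertices G) :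
    IsChordal G := by
  refine fun n hn => ⟨fun f => ?_⟩
  obtain ⟨u, v, w, huv, hvw, hne, hsub⟩ :=
    hG.exists_closedNeighborSet_subset_of_copy (by omega) f.toCopy
  rcases hsub ⟨.inl rfl, u, rfl⟩ with h | h
  · exact hne (f.injective h)
  · exact cycleGraph_not_adj_of_adj_of_adj hn huv hvw (f.map_adj_iff.1 h).symm

theorem HasSimpleVertices.exists_odd_chord {V : Type*} {G : SimpleGraph V}
    (hG : HasSimpleVertices G) {l : ℕ} (hl : 3 ≤ l)
    (f : SimpleGraph.Copy (SimpleGraph.cycleGraph (2 * l)) G) :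
    ∃ i j : Fin (2 * l), G.Adj (f i) (f j) ∧
      ¬ (SimpleGraph.cycleGraph (2 * l)).Adj i j ∧ i.val % 2 ≠ j.val % 2 := by
  obtain ⟨u, v, w, huv, hvw, hne, hsub⟩ :=
    hG.exists_closedNeighborSet_subset_of_copy (by omega) f
  obtain ⟨t, hut, htv⟩ := exists_cycleGraph_adj_ne (by omega) v u
  rcases hsub ⟨.inr (f.toHom.map_adj hut), t, rfl⟩ with h | h
  · obtain rfl := f.injective h
    exact absurd hut (cycleGraph_not_adj_of_adj_of_adj (by omega) huv hvw)
  refine ⟨w, t, h, fun hwt => ?_, ?_⟩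
  · exact cycleGraph_not_adj_of_path (by omega) hut.symm huv hvw htv hne hwt.symm
  · have := cycleGraph_val_mod_two_ne (even_two_mul l) huv
    have := cycleGraph_val_mod_two_ne (even_two_mul l) hvw
    have := cycleGraph_val_mod_two_ne (even_two_mul l) hut
    omega

theorem HasSimpleVertices.mem_stronglyChordalGraphs {G : FinGraph}
    (hG : HasSimpleVertices G.graph) : G ∈ stronglyChordalGraphs :=
  ⟨hG.isChordal, fun _ hl f => hG.exists_odd_chord hl f⟩

theorem isHereditary_burlingStronglyChordalGraphs :
    IsHereditary burlingStronglyChordalGraphs := by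
  rintro G ⟨V, hV, T, ⟨f⟩⟩ H ⟨g⟩
  exact ⟨V, hV, T, ⟨g.trans f⟩⟩

theorem burlingStronglyChordalGraphs_subset :
    burlingStronglyChordalGraphs ⊆ stronglyChordalGraphs := by
  rintro G ⟨V, hV, T, ⟨f⟩⟩
  exact (T.hasSimpleVertices_chordalGraph.comap f).mem_stronglyChordalGraphs

/-! ### The inclusion is proper -/

/-- The graph in which two vertices are adjacent if their values under `h` differ by at most one. -/
def indifferenceGraph {V : Type*} (h : V → ℕ) : SimpleGraph V :=
  SimpleGraph.fromRel fun u v => h u ≤ h v + 1 ∧ h v ≤ h u + 1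

theorem indifferenceGraph_adj {V : Type*} {h : V → ℕ} {u v : V} :
    (indifferenceGraph h).Adj u v ↔ u ≠ v ∧ h u ≤ h v + 1 ∧ h v ≤ h u + 1 := by
  simp only [indifferenceGraph, SimpleGraph.fromRel_adj]
  tauto

theorem mem_closedNeighborSet_indifferenceGraph {V : Type*} {h : V → ℕ} {u v : V} :
    v ∈ closedNeighborSet (indifferenceGraph h) u ↔ h u ≤ h v + 1 ∧ h v ≤ h u + 1 := by
  rw [mem_closedNeighborSet, indifferenceGraph_adj]
  rcases eq_or_ne v u with rfl | hne
  · simp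
  · simp [hne, hne.symm]

theorem hasSimpleVertices_indifferenceGraph {V : Type*} (h : V → ℕ) :
    HasSimpleVertices (indifferenceGraph h) := by
  intro s hs
  obtain ⟨v, hv, hmin⟩ := (measure h).wf.has_min s hs
  have subset_of_le {x y : V} (hvy : (indifferenceGraph h).Adj v y) (hxy : h x ≤ h y) :
      closedNeighborSet (indifferenceGraph h) x ∩ s ⊆
        closedNeighborSet (indifferenceGraph h) y := by
    rintro z ⟨hz, hzs⟩
    rw [mem_closedNeighborSet_indifferenceGraph] at hz ⊢
    have hvz : h v ≤ h z := not_lt.1 (hmin z hzs)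
    have := (indifferenceGraph_adj.1 hvy).2
    omega
  exact ⟨v, hv, fun x _ y _ hvx hvy =>
    (le_total (h x) (h y)).imp (subset_of_le hvy) (subset_of_le hvx)⟩

theorem BurlingTree.exists_chain_of_isClique {V : Type} [Finite V] (T : BurlingTree V)
    {s : Set V} (hs : s.Nonempty) (hclique : T.chordalGraph.IsClique s) :
    ∃ e, ∀ x ∈ s, ∀ y ∈ s, x ≠ e → y ≠ e → T.IsAncestor x y ∨ T.IsAncestor y x := by
  obtain ⟨e, he, hchain⟩ := T.exists_neighbors_chain hs
  exact ⟨e, fun x hx y hy hxe hye =>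
    hchain x hx y hy (hclique he hx hxe.symm) (hclique he hy hye.symm)⟩

theorem TreeWithRoot.comparable_of_path {V : Type} {T : TreeWithRoot V} {a b c d : V}
    (hab : T.IsAncestor a b ∨ T.IsAncestor b a) (hbc : T.IsAncestor b c ∨ T.IsAncestor c b)
    (hcd : T.IsAncestor c d ∨ T.IsAncestor d c) :
    (T.IsAncestor a c ∨ T.IsAncestor c a) ∨ T.IsAncestor b d ∨ T.IsAncestor d b := by
  rcases hbc with hbc | hcb
  · exact .inr (hcd.elim (fun h => .inl (hbc.trans h)) fun h => hbc.total h)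
  · exact .inl (hab.elim (fun h => h.total hcb) fun h => .inr (hcb.trans h))

/-- The path on four vertices with each vertex replaced by a triangle. -/
def inflatedPath : SimpleGraph (Fin 4 × Fin 3) :=
  indifferenceGraph fun v => v.1.val

theorem inflatedPath_adj {u v : Fin 4 × Fin 3} :
    inflatedPath.Adj u v ↔ u ≠ v ∧ u.1.val ≤ v.1.val + 1 ∧ v.1.val ≤ u.1.val + 1 :=
  indifferenceGraph_adj

theorem exists_chain_of_embedding_inflatedPath {V : Type} [Finite V] {T : BurlingTree V}
    (f : inflatedPath ↪g T.chordalGraph) (i : Fin 4) :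
    ∃ e, ∀ x y : Fin 4 × Fin 3, x.1.val ∈ Set.Icc i.val (i + 1) → y.1.val ∈ Set.Icc i.val (i + 1) →
      x ≠ e → y ≠ e → T.IsAncestor (f x) (f y) ∨ T.IsAncestor (f y) (f x) := by
  let layers : Set (Fin 4 × Fin 3) := {x | x.1.val ∈ Set.Icc i.val (i + 1)}
  have isClique_layers : T.chordalGraph.IsClique (f '' layers) := by
    rintro _ ⟨x, hx, rfl⟩ _ ⟨y, hy, rfl⟩ hne
    refine f.map_adj_iff.2 (inflatedPath_adj.2 ⟨fun h => hne (congrArg f h), ?_, ?_⟩)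
    · exact hx.2.trans (Nat.succ_le_succ hy.1)
    · exact hy.2.trans (Nat.succ_le_succ hx.1)
  have layers_nonempty : layers.Nonempty := ⟨(i, 0), le_rfl, Nat.le_succ _⟩
  obtain ⟨e', he'⟩ := T.exists_chain_of_isClique (layers_nonempty.image f) isClique_layers
  obtain ⟨e, he⟩ : ∃ e, ∀ x, x ≠ e → f x ≠ e' := by
    by_cases h : e' ∈ Set.range f
    · obtain ⟨e, rfl⟩ := h
      exact ⟨e, fun x => f.injective.ne⟩
    · exact ⟨(0, 0), fun x _ hx => h ⟨x, hx⟩⟩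
  exact ⟨e, fun x y hx hy hxe hye => he' _ (Set.mem_image_of_mem f hx) _
    (Set.mem_image_of_mem f hy) (he x hxe) (he y hye)⟩

theorem inflatedPath_notMem_burlingStronglyChordalGraphs :
    FinGraph.mk (Fin 4 × Fin 3) inflatedPath ∉ burlingStronglyChordalGraphs := by
  rintro ⟨V, hV, T, ⟨f⟩⟩
  change inflatedPath ↪g T.chordalGraph at f
  choose e he using exists_chain_of_embedding_inflatedPath f
  have exists_ne_ne : ∀ (i : Fin 4) (x y : Fin 4 × Fin 3), ∃ a, (i, a) ≠ x ∧ (i, a) ≠ y := by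
    decide
  obtain ⟨a, ha, -⟩ := exists_ne_ne 0 (e 0) (e 0)
  obtain ⟨b, hb₀, hb₁⟩ := exists_ne_ne 1 (e 0) (e 1)
  obtain ⟨c, hc₁, hc₂⟩ := exists_ne_ne 2 (e 1) (e 2)
  obtain ⟨d, hd, -⟩ := exists_ne_ne 3 (e 2) (e 2)
  have not_comparable {x y : Fin 4 × Fin 3} (hxy : x.1.val + 1 < y.1.val) :
      ¬ (T.IsAncestor (f x) (f y) ∨ T.IsAncestor (f y) (f x)) := fun h => by
    have hne : x ≠ y := by
      rintro rfl
      omega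
    have := inflatedPath_adj.1 (f.map_adj_iff.1
      (BurlingTree.chordalGraph_adj.2 ⟨f.injective.ne hne, .inr (.inr h)⟩))
    omega
  have hab := he 0 (0, a) (1, b) (by simp) (by simp) ha hb₀
  have hbc := he 1 (1, b) (2, c) (by simp) (by simp) hb₁ hc₁
  have hcd := he 2 (2, c) (3, d) (by simp) (by simp) hc₂ hd
  rcases TreeWithRoot.comparable_of_path hab hbc hcd with hac | hbd
  · exact not_comparable (by simp) hac
  · exact not_comparable (by simp) hbd

theorem burlingStronglyChordalGraphs_ssubset :
    burlingStronglyChordalGraphs ⊂ stronglyChordalGraphs :=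
  ⟨burlingStronglyChordalGraphs_subset, fun h => inflatedPath_notMem_burlingStronglyChordalGraphs
    (h (hasSimpleVertices_indifferenceGraph _).mem_stronglyChordalGraphs)⟩

/-! ### Forest orders and trivially perfect graphs -/

/-- The comparability graph of an order. -/
def comparabilityGraph (α : Type*) [LE α] : SimpleGraph α :=
  SimpleGraph.fromRel (· ≤ ·)

theorem isClique_comparabilityGraph (α : Type*) [LE α] :
    (comparabilityGraph α).IsClique = IsChain (· ≤ ·) := by
  ext s
  exact ⟨fun h _ ha _ hb hne => (h ha hb hne).2, fun h _ ha _ hb hne => ⟨hne, h ha hb hne⟩⟩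

section ForestOrder

variable {α : Type*} [Finite α] [PartialOrder α]

theorem setOf_maximal_isClique_comparabilityGraph [Nonempty α]
    (hα : ∀ c : α, IsChain (· ≤ ·) (Set.Iic c)) :
    {c | Maximal (comparabilityGraph α).IsClique c} = Set.Iic '' {m : α | IsMax m} := by
  rw [isClique_comparabilityGraph]
  ext c
  constructor
  · intro hc
    have hne : c.Nonempty := by
      by_contra! rfl
      exact hc.2 (y := {Classical.arbitrary α}) (Set.pairwise_singleton _ _)
        (Set.empty_subset _) rfl
    obtain ⟨x, hx⟩ := c.toFinite.exists_maximal hne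
    obtain ⟨m, hxm, hm⟩ := Finite.exists_le_maximal (p := fun _ : α => True) (a := x) trivial
    have hle : c ⊆ Set.Iic m := fun y hy =>
      ((hc.1.total hy hx.1).elim id fun h => hx.2 hy h).trans hxm
    exact ⟨m, fun y hy => hm.2 trivial hy, (hle.antisymm (hc.2 (hα m) hle)).symm⟩
  · rintro ⟨m, hm, rfl⟩
    exact ⟨hα m, fun c hc hle x hx => (hc.total hx (hle le_rfl)).elim id fun h => hm h⟩

theorem indepNum_comparabilityGraph (hα : ∀ c : α, IsChain (· ≤ ·) (Set.Iic c)) :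
    (comparabilityGraph α).indepNum = {m : α | IsMax m}.ncard := by
  classical
  apply le_antisymm
  · obtain ⟨s, hs⟩ := (comparabilityGraph α).exists_isNIndepSet_indepNum
    have hmax (a : α) : ∃ m, IsMax m ∧ a ≤ m := by
      obtain ⟨m, ham, hm⟩ := Finite.exists_le_maximal (p := fun _ : α => True) (a := a) trivial
      exact ⟨m, fun y hy => hm.2 trivial hy, ham⟩
    choose g hg hle using hmax
    rw [← hs.card_eq, ← Set.ncard_coe_finset]
    refine Set.ncard_le_ncard_of_injOn g (fun a _ => hg a) fun a ha b hb hab => ?_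
    by_contra hne
    exact hs.isIndepSet ha hb hne ⟨hne, hα (g a) (hle a) (hab ▸ hle b) hne⟩
  · have hfin := Set.toFinite {m : α | IsMax m}
    have hindep : (comparabilityGraph α).IsIndepSet (hfin.toFinset : Set α) := by
      rw [hfin.coe_toFinset]
      rintro a ha b hb hne ⟨-, h | h⟩
      exacts [hne (ha.eq_of_le h), hne (hb.eq_of_le h).symm]
    rw [Set.ncard_eq_toFinset_card _ hfin]
    exact hindep.card_le_indepNum

theorem indepNum_comparabilityGraph_eq_ncard_maximal_isClique [Nonempty α]
    (hα : ∀ c : α, IsChain (· ≤ ·) (Set.Iic c)) :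
    (comparabilityGraph α).indepNum =
      {c : Set α | Maximal (comparabilityGraph α).IsClique c}.ncard := by
  rw [indepNum_comparabilityGraph hα, setOf_maximal_isClique_comparabilityGraph hα,
    Set.ncard_image_of_injective _ Set.Iic_injective]

end ForestOrder

theorem comap_comparabilityGraph_mem_triviallyPerfectGraphs {α : Type} {β : Type*} [Finite α]
    [PartialOrder β] (hβ : ∀ c : β, IsChain (· ≤ ·) (Set.Iic c)) (f : α ↪ β) :
    FinGraph.mk α ((comparabilityGraph β).comap f) ∈ triviallyPerfectGraphs := by
  intro s hs
  have := hs.to_subtype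
  let g : s ↪ β := (Function.Embedding.subtype _).trans f
  let : PartialOrder s := PartialOrder.lift g g.injective
  have hinduce : ((comparabilityGraph β).comap f).induce s = comparabilityGraph s := by
    ext a b
    exact and_congr_left' g.injective.ne_iff
  rw [hinduce]
  exact indepNum_comparabilityGraph_eq_ncard_maximal_isClique fun c a ha b hb hne =>
    hβ (g c) ha hb (g.injective.ne hne)

/-! ### The forest order of a Burling tree -/

namespace BurlingTree

variable {V : Type} {T : BurlingTree V} {q u v w : V}

/-- Distinct or equal children of one vertex, neither of which is its last-born. -/
def FreeSiblings (T : BurlingTree V) (u v : V) : Prop :=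
  ∃ q, T.IsParent q u ∧ T.IsParent q v ∧ u ≠ T.lastBorn q ∧ v ≠ T.lastBorn q

theorem FreeSiblings.symm (h : T.FreeSiblings u v) : T.FreeSiblings v u := by
  obtain ⟨q, hu, hv, hu_ne, hv_ne⟩ := h
  exact ⟨q, hv, hu, hv_ne, hu_ne⟩

theorem FreeSiblings.trans (huv : T.FreeSiblings u v) (hvw : T.FreeSiblings v w) :
    T.FreeSiblings u w := by
  obtain ⟨q, hu, hv, hu_ne, -⟩ := huv
  obtain ⟨r, hv', hw, -, hw_ne⟩ := hvw
  obtain rfl := hv.unique hv'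
  exact ⟨q, hu, hw, hu_ne, hw_ne⟩

theorem FreeSiblings.eq_of_isAncestor (huv : T.FreeSiblings u v) (h : T.IsAncestor u v) :
    u = v := by
  obtain ⟨q, hu, hv, -, -⟩ := huv
  exact hu.eq_of_isAncestor hv h (.refl v)

theorem FreeSiblings.mayChoose (huv : T.FreeSiblings u v) (hvw : T.MayChoose v w) :
    T.MayChoose u w := by
  obtain ⟨q, hu, hv, hu_ne, -⟩ := huv
  obtain ⟨r, hv', -, hw⟩ := hvw
  obtain rfl := hv.unique hv'
  exact ⟨q, hu, hu_ne, hw⟩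

theorem MayChoose.of_freeSiblings (huv : T.MayChoose u v) (hvw : T.FreeSiblings v w) :
    T.MayChoose u w := by
  obtain ⟨q, hu, hu_ne, hv⟩ := huv
  obtain ⟨r, hv', hw, hv_ne, -⟩ := hvw
  have hne : T.lastBorn q ≠ v := by
    rintro rfl
    exact hv_ne (by rw [hv'.unique (isParent_lastBorn_of_isParent hu)])
  exact ⟨q, hu, hu_ne, (hv.of_isParent hv' hne).trans hw.isAncestor⟩

theorem MayChoose.total (hu : T.MayChoose u w) (hv : T.MayChoose v w) :
    T.FreeSiblings u v ∨ T.MayChoose u v ∨ T.MayChoose v u := by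
  obtain ⟨q, hqu, hu_ne, hqw⟩ := hu
  obtain ⟨r, hrv, hv_ne, hrw⟩ := hv
  by_cases hqr : q = r
  · subst hqr
    exact .inl ⟨q, hqu, hrv, hu_ne, hv_ne⟩
  have hq := isParent_lastBorn_of_isParent hqu
  have hr := isParent_lastBorn_of_isParent hrv
  have hne : T.lastBorn q ≠ T.lastBorn r := fun h => hqr (hq.unique (h ▸ hr))
  rcases hqw.total hrw with h | h
  · exact .inr (.inl ⟨q, hqu, hu_ne, (h.of_isParent hr hne).trans hrv.isAncestor⟩)
  · exact .inr (.inr ⟨r, hrv, hv_ne, (h.of_isParent hq hne.symm).trans hqu.isAncestor⟩)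

/-- The forest order of a Burling tree: `u` may choose `v`, or they are siblings that are not
last-born, which are ordered arbitrarily. -/
def ForestLT (T : BurlingTree V) (u v : V) : Prop :=
  T.MayChoose u v ∨ T.FreeSiblings u v ∧ WellOrderingRel u v

theorem ForestLT.not_isAncestor (h : T.ForestLT u v) :
    ¬ T.IsAncestor u v ∧ ¬ T.IsAncestor v u := by
  rcases h with h | ⟨h, hlt⟩
  · exact ⟨h.not_isAncestor_left, h.not_isAncestor_right⟩
  · exact ⟨fun huv => ne_of_irrefl hlt (h.eq_of_isAncestor huv),
      fun hvu => ne_of_irrefl' hlt (h.symm.eq_of_isAncestor hvu)⟩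

theorem ForestLT.trans (huv : T.ForestLT u v) (hvw : T.ForestLT v w) : T.ForestLT u w := by
  rcases huv with huv | ⟨huv, hlt⟩ <;> rcases hvw with hvw | ⟨hvw, hlt'⟩
  · exact .inl (huv.trans hvw)
  · exact .inl (huv.of_freeSiblings hvw)
  · exact .inl (huv.mayChoose hvw)
  · exact .inr ⟨huv.trans hvw, _root_.trans hlt hlt'⟩

theorem FreeSiblings.forestLT_or_forestLT (huv : T.FreeSiblings u v) (hne : u ≠ v) :
    T.ForestLT u v ∨ T.ForestLT v u := by
  rcases trichotomous_of WellOrderingRel u v with h | h | h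
  exacts [.inl (.inr ⟨huv, h⟩), absurd h hne, .inr (.inr ⟨huv.symm, h⟩)]

theorem ForestLT.total (hu : T.ForestLT u w) (hv : T.ForestLT v w) (hne : u ≠ v) :
    T.ForestLT u v ∨ T.ForestLT v u := by
  rcases hu with hu | ⟨hu, -⟩ <;> rcases hv with hv | ⟨hv, -⟩
  · rcases hu.total hv with h | h
    exacts [h.forestLT_or_forestLT hne, h.imp .inl .inl]
  · exact .inl (.inl (hu.of_freeSiblings hv.symm))
  · exact .inr (.inl (hv.of_freeSiblings hu.symm))
  · exact (hu.trans hv.symm).forestLT_or_forestLT hne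

instance isStrictOrder_forestLT (T : BurlingTree V) : IsStrictOrder V T.ForestLT where
  irrefl v h := h.not_isAncestor.1 (.refl v)
  trans _ _ _ := ForestLT.trans

/-- The reflexive closure of the forest order. -/
abbrev forestOrder (T : BurlingTree V) : PartialOrder V := partialOrderOfSO T.ForestLT

/-- The comparability graph of the forest order. -/
def forestGraph (T : BurlingTree V) : SimpleGraph V :=
  let := T.forestOrder
  comparabilityGraph V

theorem forestGraph_adj : T.forestGraph.Adj u v ↔ T.ForestLT u v ∨ T.ForestLT v u := by
  constructor
  · rintro ⟨hne, h | h⟩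
    exacts [.inl (h.resolve_left hne), .inr (h.resolve_left hne.symm)]
  · rintro (h | h)
    exacts [⟨ne_of_irrefl h, .inl (.inr h)⟩, ⟨ne_of_irrefl' h, .inr (.inr h)⟩]

theorem comap_forestGraph_mem_triviallyPerfectGraphs {α : Type} [Finite α] (T : BurlingTree V)
    (f : α ↪ V) : FinGraph.mk α (T.forestGraph.comap f) ∈ triviallyPerfectGraphs := by
  let := T.forestOrder
  refine comap_comparabilityGraph_mem_triviallyPerfectGraphs (fun c u hu v hv hne => ?_) f
  rcases hu with rfl | hu <;> rcases hv with rfl | hv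
  · exact absurd rfl hne
  · exact .inr (.inr hv)
  · exact .inl (.inr hu)
  · exact (hu.total hv hne).imp .inr .inr

theorem derivedGraph_eq_forestGraph_inf_chordalGraph [Finite V] (T : BurlingTree V) :
    T.derivedGraph = T.forestGraph ⊓ T.chordalGraph := by
  ext u v
  rw [SimpleGraph.inf_adj, forestGraph_adj, chordalGraph_adj, derivedGraph,
    SimpleGraph.fromRel_adj]
  constructor
  · rintro ⟨hne, h | h⟩
    · exact ⟨.inl (.inl (mayChoose_of_mem_choose h)), hne, .inl h⟩
    · exact ⟨.inr (.inl (mayChoose_of_mem_choose h)), hne, .inr (.inl h)⟩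
  · rintro ⟨hlt, hne, h⟩
    have hincomparable : ¬ T.IsAncestor u v ∧ ¬ T.IsAncestor v u :=
      hlt.elim (·.not_isAncestor) (·.not_isAncestor.symm)
    tauto

theorem mem_graphIntersection_of_embedding_derivedGraph [Finite V] (T : BurlingTree V)
    {G : FinGraph} (φ : G.graph ↪g T.derivedGraph) :
    G ∈ graphIntersection triviallyPerfectGraphs burlingStronglyChordalGraphs := by
  refine ⟨T.forestGraph.comap φ, T.chordalGraph.comap φ,
    T.comap_forestGraph_mem_triviallyPerfectGraphs φ.toEmbedding,
    ⟨V, ‹_›, T, ⟨SimpleGraph.Embedding.comap φ.toEmbedding T.chordalGraph⟩⟩, ?_⟩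
  exact φ.comap_eq.symm.trans
    (congrArg (SimpleGraph.comap φ) T.derivedGraph_eq_forestGraph_inf_chordalGraph)

end BurlingTree

/-! ### Rooted trees from parent functions -/

/-- A rooted tree given by its parent function, which is undefined at the root only. The depths
certify that every vertex reaches the root by passing to parents. -/
structure ParentMap (V : Type) where
  parent : V → Option V
  root : V
  parent_eq_none_iff : ∀ v, parent v = none ↔ v = root
  depth : V → ℕ
  depth_lt : ∀ u v, parent v = some u → depth u < depth v

namespace ParentMap

variable {V : Type} (F : ParentMap V) {u v : V}

/-- The graph that joins each vertex to its parent. -/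
def graph : SimpleGraph V where
  Adj u v := F.parent v = some u ∨ F.parent u = some v
  symm := ⟨fun _ _ h => h.symm⟩
  loopless := ⟨fun v h => (F.depth_lt v v (h.elim id id)).false⟩

theorem exists_isPath_root (v : V) :
    ∃ p : F.graph.Walk v F.root, p.IsPath ∧ ∀ x ∈ p.support, F.depth x ≤ F.depth v := by
  induction hn : F.depth v using Nat.strong_induction_on generalizing v with
  | _ n ih =>
    subst hn
    cases hv : F.parent v with
    | none =>
      obtain rfl := (F.parent_eq_none_iff v).1 hv
      exact ⟨.nil, .nil, fun x hx => by rw [SimpleGraph.Walk.mem_support_nil_iff.1 hx]⟩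
    | some u =>
      have hlt := F.depth_lt u v hv
      obtain ⟨p, hp, hle⟩ := ih _ hlt u rfl
      refine ⟨.cons (.inr hv) p, hp.cons fun hvp => (hle v hvp).not_gt hlt, fun x hx => ?_⟩
      rcases List.mem_cons.1 hx with rfl | hx
      exacts [le_rfl, (hle x hx).trans hlt.le]

theorem connected_graph : F.graph.Connected :=
  (SimpleGraph.connected_iff_exists_forall_reachable _).2
    ⟨F.root, fun v => (F.exists_isPath_root v).elim fun p _ => p.reachable.symm⟩

theorem edgeSet_graph_subset :
    F.graph.edgeSet ⊆ (fun v => s(v, (F.parent v).getD v)) '' {F.root}ᶜ := by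
  have hparent (u v : V) (h : F.parent v = some u) :
      s(v, u) ∈ (fun v => s(v, (F.parent v).getD v)) '' ({F.root}ᶜ : Set V) := by
    refine ⟨v, fun hv => ?_, by simp only [h, Option.getD_some]⟩
    rw [(F.parent_eq_none_iff v).2 hv] at h
    cases h
  intro e
  induction e with
  | _ u v => exact Or.rec (fun h => Sym2.eq_swap ▸ hparent u v h) (hparent v u)

theorem isTree_graph [Finite V] : F.graph.IsTree := by
  refine SimpleGraph.isTree_iff_connected_and_card.2 ⟨F.connected_graph,
    le_antisymm ?_ F.connected_graph.card_vert_le_card_edgeSet_add_one⟩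
  calc
    Nat.card F.graph.edgeSet + 1 ≤ ({F.root}ᶜ : Set V).ncard + 1 := by
      rw [Nat.card_coe_set_eq]
      gcongr
      exact (Set.ncard_le_ncard F.edgeSet_graph_subset (Set.toFinite _)).trans
        (Set.ncard_image_le (Set.toFinite _))
    _ = Nat.card V := by
      rw [← Set.ncard_add_ncard_compl {F.root}, Set.ncard_singleton, add_comm]

/-- The rooted tree with a given parent function. -/
def toTreeWithRoot [Finite V] : TreeWithRoot V where
  tree := F.graph
  isTree := F.isTree_graph
  root := F.root

theorem isParent_toTreeWithRoot_of_parent [Finite V] (h : F.parent v = some u) :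
    F.toTreeWithRoot.IsParent u v := by
  obtain ⟨p, hp, hle⟩ := F.exists_isPath_root u
  exact TreeWithRoot.isParent_iff_exists_isPath_cons.2
    ⟨.inr h, p, hp.cons fun hvp => (hle v hvp).not_gt (F.depth_lt u v h)⟩

theorem isParent_toTreeWithRoot [Finite V] :
    F.toTreeWithRoot.IsParent u v ↔ F.parent v = some u :=
  ⟨fun h => h.1.resolve_right fun hvu =>
    h.not_isAncestor (F.isParent_toTreeWithRoot_of_parent hvu).isAncestor,
    F.isParent_toTreeWithRoot_of_parent⟩

end ParentMap

/-! ### The Burling trees of the Burling sequence -/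

namespace Burling

instance finite_probeIdx : ∀ k, Finite (ProbeIdx k)
  | 0 => inferInstanceAs (Finite Unit)
  | k + 1 =>
    have := finite_probeIdx k
    inferInstanceAs (Finite (ProbeIdx k × ProbeIdx k × Bool))

instance finite_boxIdx : ∀ k, Finite (BoxIdx k)
  | 0 => inferInstanceAs (Finite Unit)
  | k + 1 =>
    have := finite_boxIdx k
    inferInstanceAs (Finite (BoxIdx k ⊕ (ProbeIdx k × BoxIdx k) ⊕ (ProbeIdx k × ProbeIdx k)))

section Constructors

variable {k : ℕ} {u v : BoxIdx k} {P P' Q Q' : ProbeIdx k} {b : Bool}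

/-- The box of the next family that is a translate of `v`. -/
def baseBox (v : BoxIdx k) : BoxIdx (k + 1) := .inl v

/-- The box of the next family that is the copy of `v` inside the column of `P`. -/
def copyBox (P : ProbeIdx k) (v : BoxIdx k) : BoxIdx (k + 1) := .inr (.inl (P, v))

/-- The box of the next family added for the pair of probes `P, Q`. -/
def addedBox (P Q : ProbeIdx k) : BoxIdx (k + 1) := .inr (.inr (P, Q))

/-- The two probes of the next family that stem from the pair of probes `P, Q`. -/
def nextProbe (P Q : ProbeIdx k) (b : Bool) : ProbeIdx (k + 1) := (P, Q, b)

@[elab_as_elim]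
theorem boxIdx_succ_cases {motive : BoxIdx (k + 1) → Prop} (base : ∀ v, motive (baseBox v))
    (copy : ∀ P v, motive (copyBox P v)) (added : ∀ P Q, motive (addedBox P Q))
    (v : BoxIdx (k + 1)) : motive v :=
  match v with
  | .inl v => base v
  | .inr (.inl (P, v)) => copy P v
  | .inr (.inr (P, Q)) => added P Q

theorem baseBox_injective : Function.Injective (baseBox (k := k)) :=
  Sum.inl_injective

@[simp] theorem baseBox_inj : baseBox u = baseBox v ↔ u = v :=
  baseBox_injective.eq_iff

@[simp] theorem copyBox_inj : copyBox P u = copyBox P' v ↔ P = P' ∧ u = v :=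
  (Sum.inr_injective.comp Sum.inl_injective).eq_iff.trans Prod.mk_inj

@[simp] theorem addedBox_inj : addedBox P Q = addedBox P' Q' ↔ P = P' ∧ Q = Q' :=
  (Sum.inr_injective.comp Sum.inr_injective).eq_iff.trans Prod.mk_inj

@[simp] theorem baseBox_ne_copyBox : baseBox u ≠ copyBox P v := Sum.inl_ne_inr

@[simp] theorem copyBox_ne_baseBox : copyBox P v ≠ baseBox u := Sum.inr_ne_inl

@[simp] theorem baseBox_ne_addedBox : baseBox u ≠ addedBox P Q := Sum.inl_ne_inr

@[simp] theorem addedBox_ne_baseBox : addedBox P Q ≠ baseBox u := Sum.inr_ne_inl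

@[simp] theorem copyBox_ne_addedBox : copyBox P v ≠ addedBox P' Q :=
  fun h => Sum.inl_ne_inr (Sum.inr_injective h)

@[simp] theorem addedBox_ne_copyBox : addedBox P' Q ≠ copyBox P v :=
  fun h => Sum.inr_ne_inl (Sum.inr_injective h)

theorem copyBox_mem_map {B : List (BoxIdx k)} :
    copyBox P v ∈ B.map (copyBox P') ↔ P = P' ∧ v ∈ B := by
  simp [eq_comm, and_comm]

@[simp] theorem stabs_baseBox : Stabs (k + 1) (nextProbe P Q b) (baseBox v) ↔ Stabs k P v := .rfl

@[simp] theorem stabs_copyBox : Stabs (k + 1) (nextProbe P Q b) (copyBox P' v) ↔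
    b = false ∧ P' = P ∧ Stabs k Q v := .rfl

@[simp] theorem stabs_addedBox : Stabs (k + 1) (nextProbe P Q b) (addedBox P' Q') ↔
    b = true ∧ P' = P ∧ Q' = Q := .rfl

end Constructors

/-- The root of the tree on the boxes. -/
def treeRoot : (k : ℕ) → BoxIdx k
  | 0 => ()
  | k + 1 => baseBox (treeRoot k)

/-- The leaf at which the principal branch of a probe ends. -/
def leaf : (k : ℕ) → ProbeIdx k → BoxIdx k
  | 0, _ => ()
  | k + 1, (P, Q, false) => copyBox P (leaf k Q)
  | _ + 1, (P, Q, true) => addedBox P Q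

/-- The parent function of the tree on the boxes: a copy of the previous tree is attached below the
leaf of each probe `P` of the previous family, and so are the boxes added for `P`. -/
def parent : (k : ℕ) → BoxIdx k → Option (BoxIdx k)
  | 0, _ => none
  | k + 1, .inl v => (parent k v).map baseBox
  | k + 1, .inr (.inl (P, v)) => some ((parent k v).elim (baseBox (leaf k P)) (copyBox P))
  | k + 1, .inr (.inr (P, _)) => some (baseBox (leaf k P))

/-- The number of proper ancestors of a vertex of the tree on the boxes. -/
def depth : (k : ℕ) → BoxIdx k → ℕ
  | 0, _ => 0
  | k + 1, .inl v => depth k v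
  | k + 1, .inr (.inl (P, v)) => depth k (leaf k P) + 1 + depth k v
  | k + 1, .inr (.inr (P, _)) => depth k (leaf k P) + 1

/-- The last-born children in the tree on the boxes: the last-born child of the leaf of a probe `P`
is the root of the copy of the tree attached there. The values at leaves are irrelevant. -/
noncomputable def lastBorn : (k : ℕ) → BoxIdx k → BoxIdx k
  | 0, _ => ()
  | k + 1, .inl v =>
      Function.extend (leaf k) (fun P => copyBox P (treeRoot k))
        (fun v => baseBox (lastBorn k v)) v
  | k + 1, .inr (.inl (P, v)) => copyBox P (lastBorn k v)
  | _ + 1, .inr (.inr (P, Q)) => addedBox P Q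

/-- The branch from the root to the leaf of a probe. -/
def principalBranch : (k : ℕ) → ProbeIdx k → List (BoxIdx k)
  | 0, _ => [()]
  | k + 1, (P, Q, false) =>
      (principalBranch k P).map baseBox ++ (principalBranch k Q).map (copyBox P)
  | k + 1, (P, Q, true) => (principalBranch k P).map baseBox ++ [addedBox P Q]

/-- The branch that a vertex of the tree on the boxes chooses: the box added for `P, Q` chooses the
principal branch of `Q` in the copy attached below the leaf of `P`. -/
def chosenBranch : (k : ℕ) → BoxIdx k → List (BoxIdx k)
  | 0, _ => []
  | k + 1, .inl v => (chosenBranch k v).map baseBox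
  | k + 1, .inr (.inl (P, v)) => (chosenBranch k v).map (copyBox P)
  | k + 1, .inr (.inr (P, Q)) => (principalBranch k Q).map (copyBox P)

section

variable {k : ℕ} {v : BoxIdx k} {P Q : ProbeIdx k}

@[simp] theorem leaf_nextProbe_false : leaf (k + 1) (nextProbe P Q false) = copyBox P (leaf k Q) :=
  rfl

@[simp] theorem leaf_nextProbe_true : leaf (k + 1) (nextProbe P Q true) = addedBox P Q := rfl

@[simp] theorem parent_baseBox : parent (k + 1) (baseBox v) = (parent k v).map baseBox := rfl

@[simp] theorem parent_copyBox : parent (k + 1) (copyBox P v) =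
    some ((parent k v).elim (baseBox (leaf k P)) (copyBox P)) := rfl

@[simp] theorem parent_addedBox : parent (k + 1) (addedBox P Q) = some (baseBox (leaf k P)) := rfl

@[simp] theorem depth_baseBox : depth (k + 1) (baseBox v) = depth k v := rfl

@[simp] theorem depth_copyBox :
    depth (k + 1) (copyBox P v) = depth k (leaf k P) + 1 + depth k v := rfl

@[simp] theorem lastBorn_copyBox : lastBorn (k + 1) (copyBox P v) = copyBox P (lastBorn k v) := rfl

@[simp] theorem principalBranch_nextProbe_false :
    principalBranch (k + 1) (nextProbe P Q false) =
      (principalBranch k P).map baseBox ++ (principalBranch k Q).map (copyBox P) := rfl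

@[simp] theorem principalBranch_nextProbe_true :
    principalBranch (k + 1) (nextProbe P Q true) =
      (principalBranch k P).map baseBox ++ [addedBox P Q] := rfl

@[simp] theorem chosenBranch_baseBox :
    chosenBranch (k + 1) (baseBox v) = (chosenBranch k v).map baseBox := rfl

@[simp] theorem chosenBranch_copyBox :
    chosenBranch (k + 1) (copyBox P v) = (chosenBranch k v).map (copyBox P) := rfl

@[simp] theorem chosenBranch_addedBox :
    chosenBranch (k + 1) (addedBox P Q) = (principalBranch k Q).map (copyBox P) := rfl

end

@[elab_as_elim]
theorem probeIdx_induction {motive : ∀ k, ProbeIdx k → Prop} (zero : ∀ P, motive 0 P)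
    (next : ∀ k P Q b, motive k P → motive k Q → motive (k + 1) (nextProbe P Q b))
    (k : ℕ) (P : ProbeIdx k) : motive k P :=
  match k, P with
  | 0, P => zero P
  | k + 1, (P, Q, b) =>
    next k P Q b (probeIdx_induction zero next k P) (probeIdx_induction zero next k Q)

theorem mem_principalBranch_iff {k : ℕ} {P : ProbeIdx k} {v : BoxIdx k} :
    v ∈ principalBranch k P ↔ Stabs k P v := by
  induction k, P using probeIdx_induction with
  | zero => exact ⟨fun _ => trivial, fun _ => List.mem_singleton.2 rfl⟩
  | next _ _ _ b ihP ihQ =>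
    cases v using boxIdx_succ_cases <;> cases b <;> simp [ihP, ihQ, eq_comm, and_comm]

theorem abstractAdj_iff_mem_chosenBranch {k : ℕ} {u v : BoxIdx k} :
    AbstractAdj k u v ↔ v ∈ chosenBranch k u ∨ u ∈ chosenBranch k v := by
  induction k with
  | zero => simp [AbstractAdj, chosenBranch]
  | succ k ih =>
    cases u using boxIdx_succ_cases <;> cases v using boxIdx_succ_cases
    case base.base => exact ih.trans (by simp)
    case copy.copy =>
      exact (and_congr_right' ih).trans (by simp [copyBox_mem_map, and_or_left, eq_comm])
    case copy.added =>
      exact .trans (and_congr_right' mem_principalBranch_iff.symm) (by simp [copyBox_mem_map])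
    case added.copy =>
      exact .trans (and_congr_right' mem_principalBranch_iff.symm)
        (by simp [copyBox_mem_map, eq_comm])
    all_goals exact iff_of_false id (by simp)

theorem leaf_injective (k : ℕ) : Function.Injective (leaf k) := by
  induction k with
  | zero => exact fun P Q _ => Subsingleton.elim (α := Unit) P Q
  | succ k ih =>
    rintro ⟨P, Q, _ | _⟩ ⟨P', Q', _ | _⟩ h
    · obtain ⟨h, h'⟩ := copyBox_inj.1 h
      rw [h, ih h']
    · exact absurd h copyBox_ne_addedBox
    · exact absurd h addedBox_ne_copyBox
    · obtain ⟨h, h'⟩ := addedBox_inj.1 h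
      rw [h, h']

theorem parent_eq_none_iff {k : ℕ} {v : BoxIdx k} : parent k v = none ↔ v = treeRoot k := by
  induction k with
  | zero => exact ⟨fun _ => rfl, fun _ => rfl⟩
  | succ k ih => cases v using boxIdx_succ_cases <;> simp [treeRoot, ih]

@[simp] theorem parent_treeRoot (k : ℕ) : parent k (treeRoot k) = none :=
  parent_eq_none_iff.2 rfl

@[elab_as_elim]
theorem parent_induction
    {motive : ∀ (k : ℕ) (u v : BoxIdx k), parent k v = some u → Prop}
    (base : ∀ k u v h (h' : parent (k + 1) (baseBox v) = some (baseBox u)), motive k u v h →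
      motive (k + 1) (baseBox u) (baseBox v) h')
    (copy : ∀ k P u v h (h' : parent (k + 1) (copyBox P v) = some (copyBox P u)), motive k u v h →
      motive (k + 1) (copyBox P u) (copyBox P v) h')
    (copyRoot : ∀ k P h, motive (k + 1) (baseBox (leaf k P)) (copyBox P (treeRoot k)) h)
    (added : ∀ k P Q h, motive (k + 1) (baseBox (leaf k P)) (addedBox P Q) h)
    (k : ℕ) (u v : BoxIdx k) (h : parent k v = some u) : motive k u v h := by
  induction k with
  | zero => cases h
  | succ k ih =>
    cases v using boxIdx_succ_cases with
    | base v =>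
      obtain ⟨u, hv, rfl⟩ := Option.map_eq_some_iff.1 h
      exact base k u v hv h (ih u v hv)
    | copy P v =>
      cases hv : parent k v with
      | none =>
        obtain rfl := parent_eq_none_iff.1 hv
        obtain rfl : baseBox (leaf k P) = u := by simpa [hv] using h
        exact copyRoot k P h
      | some w =>
        obtain rfl : copyBox P w = u := by simpa [hv] using h
        exact copy k P w v hv h (ih w v hv)
    | added P Q =>
      obtain rfl := Option.some_injective _ h
      exact added k P Q h

theorem depth_lt_of_parent {k : ℕ} {u v : BoxIdx k} (h : parent k v = some u) :
    depth k u < depth k v := by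
  induction k, u, v, h using parent_induction with
  | base _ _ _ _ _ ih => exact ih
  | copy _ _ _ _ _ _ ih => exact Nat.add_lt_add_left ih _
  | copyRoot => simp only [depth_baseBox, depth_copyBox]; lia
  | added => exact Nat.lt_succ_self _

theorem parent_ne_leaf (k : ℕ) (v : BoxIdx k) (P : ProbeIdx k) : parent k v ≠ some (leaf k P) := by
  intro h
  generalize hu : leaf k P = u at h
  induction k, u, v, h using parent_induction with
  | base | copyRoot | added => obtain ⟨_, _, _ | _⟩ := P <;> cases hu
  | copy _ _ _ _ _ _ ih =>
    obtain ⟨P, Q, _ | _⟩ := P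
    · exact ih Q (copyBox_inj.1 hu).2
    · exact addedBox_ne_copyBox hu

theorem lastBorn_baseBox_leaf (k : ℕ) (P : ProbeIdx k) :
    lastBorn (k + 1) (baseBox (leaf k P)) = copyBox P (treeRoot k) :=
  (leaf_injective k).extend_apply _ _ _

theorem lastBorn_baseBox_of_parent {k : ℕ} {u v : BoxIdx k} (h : parent k v = some u) :
    lastBorn (k + 1) (baseBox u) = baseBox (lastBorn k u) := by
  refine Function.extend_apply' _ _ _ ?_
  rintro ⟨P, rfl⟩
  exact parent_ne_leaf k v P h

theorem parent_lastBorn {k : ℕ} {u v : BoxIdx k} (h : parent k v = some u) :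
    parent k (lastBorn k u) = some u := by
  induction k, u, v, h using parent_induction with
  | base _ _ _ h _ ih => simp [lastBorn_baseBox_of_parent h, ih]
  | copy _ _ _ _ _ _ ih => simp [ih]
  | copyRoot | added => simp [lastBorn_baseBox_leaf]

theorem chosenBranch_treeRoot (k : ℕ) : chosenBranch k (treeRoot k) = [] := by
  induction k with
  | zero => rfl
  | succ k ih => simp [treeRoot, ih]

theorem chosenBranch_lastBorn {k : ℕ} {u v : BoxIdx k} (h : parent k v = some u) :
    chosenBranch k (lastBorn k u) = [] := by
  induction k, u, v, h using parent_induction with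
  | base _ _ _ h _ ih => simp [lastBorn_baseBox_of_parent h, ih]
  | copy _ _ _ _ _ _ ih => simp [ih]
  | copyRoot | added => simp [lastBorn_baseBox_leaf, chosenBranch_treeRoot]

theorem head?_principalBranch (k : ℕ) (P : ProbeIdx k) :
    (principalBranch k P).head? = some (treeRoot k) := by
  induction k, P using probeIdx_induction with
  | zero => rfl
  | next _ _ _ b ihP _ => cases b <;> simp [ihP, treeRoot]

theorem getLast?_principalBranch (k : ℕ) (P : ProbeIdx k) :
    (principalBranch k P).getLast? = some (leaf k P) := by
  induction k, P using probeIdx_induction with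
  | zero => rfl
  | next _ _ _ b _ ihQ => cases b <;> simp [ihQ]

theorem head?_chosenBranch {k : ℕ} {u v : BoxIdx k} (h : parent k v = some u)
    (hne : v ≠ lastBorn k u) :
    chosenBranch k v = [] ∨ (chosenBranch k v).head? = some (lastBorn k u) := by
  induction k, u, v, h using parent_induction with
  | base _ _ _ h _ ih =>
    rw [lastBorn_baseBox_of_parent h] at hne ⊢
    exact (ih (baseBox_inj.not.1 hne)).imp (fun h => by simp [h]) fun h => by simp [h]
  | copy _ _ _ _ _ _ ih =>
    exact (ih (by simpa using hne)).imp (fun h => by simp [h]) fun h => by simp [h]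
  | copyRoot k P => exact absurd (lastBorn_baseBox_leaf k P).symm hne
  | added => exact .inr (by simp [head?_principalBranch, lastBorn_baseBox_leaf])

/-- The tree on the boxes. -/
def rootedTree (k : ℕ) : TreeWithRoot (BoxIdx k) :=
  ParentMap.toTreeWithRoot
    { parent := parent k
      root := treeRoot k
      parent_eq_none_iff := fun _ => parent_eq_none_iff
      depth := depth k
      depth_lt := fun _ _ => depth_lt_of_parent }

theorem isParent_rootedTree {k : ℕ} {u v : BoxIdx k} :
    (rootedTree k).IsParent u v ↔ parent k v = some u :=
  ParentMap.isParent_toTreeWithRoot _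

theorem not_isLeaf_rootedTree_iff {k : ℕ} {u : BoxIdx k} :
    ¬ (rootedTree k).IsLeaf u ↔ ∃ v, parent k v = some u := by
  simp only [TreeWithRoot.IsLeaf, isParent_rootedTree, not_forall, not_not]

theorem isBranch_map_baseBox {k : ℕ} {B : List (BoxIdx k)} (hB : (rootedTree k).IsBranch B) :
    (rootedTree (k + 1)).IsBranch (B.map baseBox) :=
  (List.isChain_map _).2 <| hB.imp fun u v h => by
    simp only [isParent_rootedTree] at h ⊢
    simp [h]

theorem isBranch_map_copyBox {k : ℕ} (P : ProbeIdx k) {B : List (BoxIdx k)}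
    (hB : (rootedTree k).IsBranch B) : (rootedTree (k + 1)).IsBranch (B.map (copyBox P)) :=
  (List.isChain_map _).2 <| hB.imp fun u v h => by
    simp only [isParent_rootedTree] at h ⊢
    simp [h]

theorem isBranch_principalBranch (k : ℕ) (P : ProbeIdx k) :
    (rootedTree k).IsBranch (principalBranch k P) := by
  induction k, P using probeIdx_induction with
  | zero => exact .singleton _
  | next _ P _ b ihP ihQ =>
    have hbase := isBranch_map_baseBox ihP
    cases b
    · exact List.isChain_append.2 ⟨hbase, isBranch_map_copyBox P ihQ, by
        simp [getLast?_principalBranch, head?_principalBranch, isParent_rootedTree]⟩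
    · exact List.isChain_append.2 ⟨hbase, .singleton _, by
        simp [getLast?_principalBranch, isParent_rootedTree]⟩

theorem isBranch_chosenBranch (k : ℕ) (v : BoxIdx k) :
    (rootedTree k).IsBranch (chosenBranch k v) := by
  induction k with
  | zero => exact .nil
  | succ k ih =>
    cases v using boxIdx_succ_cases with
    | base v => exact isBranch_map_baseBox (ih v)
    | copy P v => exact isBranch_map_copyBox P (ih v)
    | added P Q => exact isBranch_map_copyBox P (isBranch_principalBranch k Q)

/-- The Burling tree on the boxes of the family `k`. -/
noncomputable def burlingTree (k : ℕ) : BurlingTree (BoxIdx k) where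
  toTreeWithRoot := rootedTree k
  lastBorn := lastBorn k
  isParent_lastBorn u hu := by
    obtain ⟨v, hv⟩ := not_isLeaf_rootedTree_iff.1 hu
    exact isParent_rootedTree.2 (parent_lastBorn hv)
  choose v := {w | w ∈ chosenBranch k v}
  choose_of_ne_lastBorn u v h hne :=
    ⟨chosenBranch k v, isBranch_chosenBranch k v,
      head?_chosenBranch (isParent_rootedTree.1 h) hne, rfl⟩
  choose_lastBorn u hu := by
    obtain ⟨v, hv⟩ := not_isLeaf_rootedTree_iff.1 hu
    simp only [chosenBranch_lastBorn hv, List.not_mem_nil, Set.ofPred_false]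
  choose_root := by
    change {w | w ∈ chosenBranch k (treeRoot k)} = ∅
    simp only [chosenBranch_treeRoot, List.not_mem_nil, Set.ofPred_false]

theorem burlingSequence_eq_derivedGraph (k : ℕ) :
    burlingSequence k = (burlingTree k).derivedGraph := by
  ext u v
  rw [burlingSequence_adj, abstractAdj_iff_mem_chosenBranch]
  rfl

end Burling

theorem burlingGraphs_subset_graphIntersection :
    burlingGraphs ⊆ graphIntersection triviallyPerfectGraphs burlingStronglyChordalGraphs := by
  rintro G ⟨k, ⟨φ⟩⟩
  rw [Burling.burlingSequence_eq_derivedGraph] at φ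
  exact (Burling.burlingTree k).mem_graphIntersection_of_embedding_derivedGraph φ

/-- The Burling strongly chordal graphs form a (hereditary) proper subclass of the strongly chordal
graphs, and the class of Burling graphs is a subclass of the graph-intersection of the class of
trivially perfect graphs with this class. -/
theorem mainTheorem5 :
    IsHereditary burlingStronglyChordalGraphs ∧
    burlingStronglyChordalGraphs ⊂ stronglyChordalGraphs ∧
    burlingGraphs ⊆ graphIntersection triviallyPerfectGraphs burlingStronglyChordalGraphs :=
  ⟨isHereditary_burlingStronglyChordalGraphs, burlingStronglyChordalGraphs_ssubset,
    burlingGraphs_subset_graphIntersection⟩
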